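/- Let $\mathfrak g$ be a finite-dimensional complex simple Lie algebra of type $B_n$, $n\ge 1$ (where $B_1=A_1$), let $\mathfrak h$ be a Cartan subalgebra, let $\Delta^+$ be a positive system in the root system of $(\mathfrak g,\mathfrak h)$, and let $\mathfrak b=\mathfrak h\oplus\bigoplus_{\alpha\in\Delta^+}\mathfrak g_\alpha$ be the corresponding Borel subalgebra. Let $\mathcal I^n$ be the set of ad-nilpotent ideals of $\mathfrak b$, that is, the ideals of $\mathfrak b$ all of whose elements are ad-nilpotent. The class of nilpotence of $\mathfrak i\in\mathcal I^n$ is the smallest $m\ge 0$ such that $\mathfrak i^{m+1}=0$, where $\mathfrak i^1=\mathfrak i$ and $\mathfrak i^{k+1}=[\mathfrak i,\mathfrak i^k]$; thus the zero ideal has class $0$, and the abelian ideals are those of class at most $1$. Let $F_k$ be the Fibonacci numbers with the indexing $F_0=F_1=1$, $F_{k+2}=F_{k+1}+F_k$. Then the number of ideals in $\mathcal I^n$ with class of nilpotence at most $2$ is $$F_{2n}+F_{2n-2}-2^{n-1},$$ and the number of ideals in $\mathcal I^n$ with class of nilpotence at most $3$ is $$\frac{5\cdot 3^{n-1}+1}{2}-F_{2n-2}.$$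 -/

import Mathlib

open LieAlgebra LieAlgebra.IsKilling

section Borel

variable {L : Type*} [LieRing L] [LieAlgebra ℂ L] [FiniteDimensional ℂ L] [LieAlgebra.IsSimple ℂ L]
  {H : LieSubalgebra ℂ L} [H.IsCartanSubalgebra]

/-- The Borel subalgebra `𝔟 = 𝔥 ⊕ ⨁_{α > 0} 𝔤_α` attached to a Cartan subalgebra `𝔥 = H` and to the
positive system consisting of the roots that are positive with respect to the base `b`. -/
noncomputable def borelSubalgebra (b : (rootSystem H).Base) : LieSubalgebra ℂ L where
  __ := H.toSubmodule ⊔ ⨆ α : {α : H.root // b.IsPos α}, (rootSpace H α.1.1).toSubmodule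
  lie_mem' := by
    set N : Submodule ℂ L :=
      ⨆ α : {α : H.root // b.IsPos α}, (rootSpace H α.1.1).toSubmodule with hN
    have hle (α : {α : H.root // b.IsPos α}) :
        (rootSpace H α.1.1).toSubmodule ≤ N :=
      le_iSup (fun α : {α : H.root // b.IsPos α} ↦ (rootSpace H α.1.1).toSubmodule) α
    let f : L →ₗ[ℂ] L →ₗ[ℂ] L := (LieAlgebra.ad ℂ L : L →ₗ[ℂ] Module.End ℂ L)
    suffices h : Submodule.map₂ f (H.toSubmodule ⊔ N) (H.toSubmodule ⊔ N) ≤ H.toSubmodule ⊔ N by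
      intro x y hx hy
      exact h (Submodule.apply_mem_map₂ f hx hy)
    rw [Submodule.map₂_sup_left, Submodule.map₂_sup_right, Submodule.map₂_sup_right]
    refine sup_le (sup_le ?_ ?_) (sup_le ?_ ?_)
    · exact (Submodule.map₂_le.mpr fun x hx y hy ↦ H.lie_mem hx hy).trans le_sup_left
    · refine le_trans ?_ le_sup_right
      conv_lhs => rw [hN]
      rw [Submodule.map₂_iSup_right]
      refine iSup_le fun α ↦ Submodule.map₂_le.mpr fun x hx y hy ↦ hle α ?_
      exact (rootSpace H α.1.1).lie_mem (x := (⟨x, hx⟩ : H)) hy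
    · refine le_trans ?_ le_sup_right
      conv_lhs => rw [hN]
      rw [Submodule.map₂_iSup_left]
      refine iSup_le fun α ↦ Submodule.map₂_le.mpr fun x hx y hy ↦ hle α ?_
      change ⁅x, y⁆ ∈ _
      rw [← lie_skew]
      exact neg_mem ((rootSpace H α.1.1).lie_mem (x := (⟨y, hy⟩ : H)) hx)
    · refine le_trans ?_ le_sup_right
      conv_lhs => rw [hN]
      rw [Submodule.map₂_iSup_left]
      refine iSup_le fun α ↦ ?_
      rw [Submodule.map₂_iSup_right]
      refine iSup_le fun β ↦ Submodule.map₂_le.mpr fun x hx y hy ↦ ?_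
      have hxy : ⁅x, y⁆ ∈ rootSpace H (⇑α.1.1 + ⇑β.1.1) :=
        lie_mem_genWeightSpace_of_mem_genWeightSpace hx hy
      change ⁅x, y⁆ ∈ N
      by_cases hbot : rootSpace H (⇑α.1.1 + ⇑β.1.1) = ⊥
      · rw [hbot, LieSubmodule.mem_bot] at hxy
        rw [hxy]; exact zero_mem _
      let γ : LieModule.Weight ℂ H L := ⟨⇑α.1.1 + ⇑β.1.1, hbot⟩
      have hγ : γ.IsNonZero := by
        intro h0
        have h1 : (rootSystem H).root α.1 = -(rootSystem H).root β.1 := by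
          ext x
          have := congrFun h0 x
          simpa [γ, eq_neg_iff_add_eq_zero] using this
        let := (rootSystem H).indexNeg
        have h2 : α.1 = -β.1 := by
          apply (rootSystem H).root.injective
          rw [h1, RootPairing.indexNeg_neg, RootPairing.root_reflectionPerm,
            RootPairing.reflection_apply_self]
        have h3 := α.2
        have h4 := β.2
        rw [RootPairing.Base.isPos_iff] at h3 h4
        rw [h2, b.height_reflectionPerm_self] at h3
        omega
      have hγ' : γ ∈ H.root := by simpa using hγ
      have hpos : b.IsPos ⟨γ, hγ'⟩ := α.2.add β.2 (by ext x; simp [γ])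
      exact hle ⟨⟨γ, hγ'⟩, hpos⟩ hxy

/-- An ideal of the Borel subalgebra is ad-nilpotent if it consists of ad-nilpotent elements of the
ambient Lie algebra. -/
def IsAdNilpotentIdeal {b : (rootSystem H).Base} (I : LieIdeal ℂ (borelSubalgebra b)) : Prop :=
  ∀ x ∈ I, _root_.IsNilpotent (LieAlgebra.ad ℂ L (x : L))

/-- The class of nilpotence of an ideal of the Borel subalgebra: the least `m` such that
`𝔦^(m+1) = [⋯[𝔦, 𝔦], ⋯, 𝔦]` (with `m` brackets, that is `m + 1` occurrences of `𝔦`) vanishes.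
It is `0` exactly for the zero ideal and at most `1` exactly for abelian ideals. It is only used
for ad-nilpotent ideals, which are always nilpotent Lie algebras (see
`IsAdNilpotentIdeal.isNilpotent`), so that such an `m` exists. -/
noncomputable def nilpotenceClass {b : (rootSystem H).Base}
    (I : LieIdeal ℂ (borelSubalgebra b)) : ℕ :=
  LieModule.nilpotencyLength I I

theorem IsAdNilpotentIdeal.isNilpotent {b : (rootSystem H).Base}
    {I : LieIdeal ℂ (borelSubalgebra b)} (hI : IsAdNilpotentIdeal I) : LieRing.IsNilpotent I := by
  rw [LieAlgebra.isNilpotent_iff_forall (R := ℂ)]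
  rintro ⟨x, hx⟩
  obtain ⟨k, hk⟩ := hI x hx
  refine ⟨k, ?_⟩
  ext y
  have key : ∀ m, ((((LieAlgebra.ad ℂ I ⟨x, hx⟩) ^ m) y : borelSubalgebra b) : L)
      = ((LieAlgebra.ad ℂ L (x : L)) ^ m) ((y : borelSubalgebra b) : L) := by
    intro m
    induction m with
    | zero => simp
    | succ m ih => rw [pow_succ', pow_succ', Module.End.mul_apply, Module.End.mul_apply, ← ih]; rfl
  simp [key, hk]

/-- The root system is of type `B_n` (with `B_1 = A_1`): its Cartan matrix with respect to the base
`b` is, after numbering the simple roots suitably, the Cartan matrix of type `B_n`, in which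
`α_1, …, α_{n-1}` are long and `α_n` is short. -/
def IsTypeB (b : (rootSystem H).Base) (n : ℕ) : Prop :=
  ∃ e : Fin n ≃ b.support, ∀ i j, b.cartanMatrix (e i) (e j) = CartanMatrix.B n i j

end Borel

/-- The Fibonacci numbers in the indexing `F_0 = F_1 = 1`, `F_{k+2} = F_{k+1} + F_k`. -/
def fibonacci (k : ℕ) : ℕ := Nat.fib (k + 1)

/-! An ad-nilpotent ideal of the Borel subalgebra is `H`-stable and meets `H` in zero, so it is a
sum of root spaces. These ideals correspond to the sets Φ of positive roots closed under adding
positive roots. Since [𝔤_α, 𝔤_β] = 𝔤_{α+β} whenever α + β is a root, the lower central series is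
read off from Φ: the class is at most m iff no root is an iterated sum of m + 1 roots of Φ
(`nilpotenceClass_le_iff`).

In type B_n, with ε_{n+1} = 0 and ε_{2n+2-k} = -ε_k, the positive roots are the ε_i - ε_j with i < j
and i + j ≠ 2n + 2, where (i, j) and its mirror (2n + 2 - j, 2n + 2 - i) name the same root.
Choosing i + j ≤ 2n + 1 turns Φ into a set of cells bounded by a lattice path. Two positive roots
add up to a root only as (ε_x - ε_y) + (ε_y - ε_z) (`exists_chain_of_root_eq_add`). As ε_1 - ε_{2n}
is the highest root, class at most m means that no chain of m + 1 links leads from 1 to 2n.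

For m = 2 and m = 3 the absence of chains splits into alternatives, each fixing where the boundary
path passes (`not_exists_three_chain_iff`, `not_exists_four_chain_iff`). Every alternative is then
counted by binomial coefficients times a power of two (`ncard_rowStart`, `ncard_colStart`,
`ncard_right`). For three links the alternatives contribute 2^n, F_{2n} - 2^n and F_{2n-2} -
2^{n-1}; for four links they contribute (3^n + 1)/2 and 3^{n-1} - F_{2n-2}. -/

/-! ### Filters of cells and lattice path counts -/

/-- The order filters of the part of the root poset of type `B_n` in rows `≥ i` and columns `≥ x`,
where the positive root `ε_k - ε_y` (with `ε_{2n+2-y} = -ε_y`) sits in row `k` and column `y`. -/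
def rootFilters (n i x : ℕ) : Set (Set (ℕ × ℕ)) :=
  {D | (∀ k y, (k, y) ∈ D → i ≤ k ∧ x ≤ y ∧ k < y ∧ k + y ≤ 2 * n + 1) ∧
    (∀ k y, (k, y) ∈ D → k + y + 1 ≤ 2 * n + 1 → (k, y + 1) ∈ D) ∧
    (∀ k y, (k + 1, y) ∈ D → i ≤ k → (k, y) ∈ D)}

/-- Row `i` of `D` has no entries in the columns before `y`. -/
def RowGap (D : Set (ℕ × ℕ)) (i y : ℕ) : Prop := ∀ j < y, (i, j) ∉ D

/-- The entries of row `i` in columns `≥ x`. -/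
def rowFrom (n i x : ℕ) : Set (ℕ × ℕ) := {p | p.1 = i ∧ x ≤ p.2 ∧ i + p.2 ≤ 2 * n + 1}

theorem mem_rowFrom {n i x k y : ℕ} : (k, y) ∈ rowFrom n i x ↔ k = i ∧ x ≤ y ∧ i + y ≤ 2 * n + 1 :=
  Iff.rfl

namespace rootFilters

variable {n i x : ℕ} {D : Set (ℕ × ℕ)}

theorem mem_of_le (hD : D ∈ rootFilters n i x) {k y k' y' : ℕ} (h : (k, y) ∈ D) (hi : i ≤ k')
    (hk : k' ≤ k) (hy : y ≤ y') (hn : k' + y' ≤ 2 * n + 1) : (k', y') ∈ D := by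
  have h1 : (k', y) ∈ D := by
    obtain ⟨d, rfl⟩ := Nat.exists_eq_add_of_le hk
    clear hk hn
    induction d with
    | zero => exact h
    | succ d ih => exact ih (hD.2.2 _ _ h (by omega))
  obtain ⟨d, rfl⟩ := Nat.exists_eq_add_of_le hy
  clear hy
  induction d with
  | zero => exact h1
  | succ d ih => exact hD.2.1 _ _ (ih (by omega)) (by omega)

theorem finite (n i x : ℕ) : (rootFilters n i x).Finite := by
  refine (Set.Finite.finite_subsets ((Set.finite_Iic (2 * n + 1)).prod
    (Set.finite_Iic (2 * n + 1)))).subset fun D hD p hp ↦ ?_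
  have := hD.1 p.1 p.2 hp
  simp only [Set.mem_prod, Set.mem_Iic]
  omega

theorem eq_of_antidiagonal_le (h : 2 * n + 2 ≤ i + x) : rootFilters n i x = {∅} := by
  ext D
  simp only [Set.mem_singleton_iff]
  constructor
  · intro hD
    ext ⟨k, y⟩
    simp only [Set.mem_empty_iff_false, iff_false]
    intro hp
    have := hD.1 k y hp
    omega
  · rintro rfl
    simp [rootFilters]

/-- Row `i` is the top row, so by closure a gap there is a gap in every row below. -/
theorem rowGap_iff {y : ℕ} (hxy : x ≤ y) :
    (D ∈ rootFilters n i x ∧ RowGap D i y) ↔ D ∈ rootFilters n i y := by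
  constructor
  · rintro ⟨hD, hg⟩
    refine ⟨fun k z hk ↦ ?_, hD.2.1, hD.2.2⟩
    have h := hD.1 k z hk
    refine ⟨h.1, ?_, h.2.2⟩
    by_contra hz
    exact hg z (by omega) (mem_of_le hD hk le_rfl h.1 le_rfl (by omega))
  · intro hD
    refine ⟨⟨fun k z hk ↦ ?_, hD.2.1, hD.2.2⟩, fun j hj h ↦ ?_⟩
    · have := hD.1 k z hk
      omega
    · have := hD.1 _ _ h
      omega

theorem union_rowFrom_mem (hx : i < x) (hD : D ∈ rootFilters n (i + 1) x) :
    D ∪ rowFrom n i x ∈ rootFilters n i x := by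
  refine ⟨fun k y h ↦ ?_, fun k y h hn ↦ ?_, fun k y h hk ↦ ?_⟩
  · rcases h with h | h
    · have := hD.1 _ _ h
      omega
    · rw [mem_rowFrom] at h
      omega
  · rcases h with h | h
    · exact Or.inl (hD.2.1 _ _ h hn)
    · right
      rw [mem_rowFrom] at h ⊢
      omega
  · rcases h with h | h
    · rcases hk.eq_or_lt with rfl | hk
      · right
        have := hD.1 _ _ h
        rw [mem_rowFrom]
        omega
      · exact Or.inl (hD.2.2 _ _ h hk)
    · rw [mem_rowFrom] at h
      omega

/-- A filter whose row `i` starts in column `x` is a filter on the rows below together with the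
whole row `i`. -/
theorem ncard_mem_corner (hx : i < x) (hn : i + x ≤ 2 * n + 1) (P : Set (ℕ × ℕ) → Prop) :
    {D ∈ rootFilters n i x | (i, x) ∈ D ∧ P D}.ncard =
      {D ∈ rootFilters n (i + 1) x | P (D ∪ rowFrom n i x)}.ncard := by
  symm
  refine Set.ncard_congr (fun D _ ↦ D ∪ rowFrom n i x) ?_ ?_ ?_
  · rintro D ⟨hD, hP⟩
    exact ⟨union_rowFrom_mem hx hD, Or.inr (mem_rowFrom.2 (by omega)), hP⟩
  · rintro D D' ⟨hD, -⟩ ⟨hD', -⟩ h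
    ext ⟨k, y⟩
    have h' := Set.ext_iff.1 h (k, y)
    simp only [Set.mem_union, mem_rowFrom] at h'
    constructor
    · intro hk
      have := hD.1 _ _ hk
      rcases h'.1 (Or.inl hk) with h | h
      · exact h
      · omega
    · intro hk
      have := hD'.1 _ _ hk
      rcases h'.2 (Or.inl hk) with h | h
      · exact h
      · omega
  · rintro D ⟨hD, hm, hP⟩
    have he : {p ∈ D | i + 1 ≤ p.1} ∪ rowFrom n i x = D := by
      ext ⟨k, y⟩
      simp only [Set.mem_union, Set.mem_ofPred_eq, mem_rowFrom]
      constructor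
      · rintro (h | ⟨rfl, h, h'⟩)
        · exact h.1
        · exact mem_of_le hD hm le_rfl le_rfl h h'
      · intro h
        have := hD.1 _ _ h
        by_cases hk : i + 1 ≤ k
        · exact Or.inl ⟨h, hk⟩
        · right; omega
    refine ⟨{p ∈ D | i + 1 ≤ p.1}, ⟨⟨fun k y h ↦ ?_, fun k y h h' ↦ ?_, fun k y h h' ↦ ?_⟩, ?_⟩, he⟩
    · have := hD.1 _ _ h.1
      have h2 : i + 1 ≤ k := h.2
      omega
    · exact ⟨hD.2.1 _ _ h.1 h', h.2⟩
    · exact ⟨hD.2.2 _ _ h.1 (by omega), h'⟩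
    · rwa [he]

/-- One step of the boundary path: either the corner cell is missing, and with it column `x`, or it
is present, and with it all of row `i`. This Pascal recursion drives all the counts. -/
theorem ncard_split (hx : i < x) (hn : i + x ≤ 2 * n + 1) (P : Set (ℕ × ℕ) → Prop) :
    {D ∈ rootFilters n i x | P D}.ncard =
      {D ∈ rootFilters n i (x + 1) | P D}.ncard +
        {D ∈ rootFilters n (i + 1) x | P (D ∪ rowFrom n i x)}.ncard := by
  rw [← ncard_mem_corner hx hn, ← Set.ncard_union_eq _
    ((finite n i (x + 1)).subset fun D h ↦ h.1) ((finite n i x).subset fun D h ↦ h.1)]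
  · congr 1
    ext D
    simp only [Set.mem_ofPred_eq, Set.mem_union]
    rw [← rowGap_iff (Nat.le_succ x)]
    constructor
    · rintro ⟨hD, hP⟩
      by_cases h : (i, x) ∈ D
      · exact Or.inr ⟨hD, h, hP⟩
      · refine Or.inl ⟨⟨hD, fun j hj hjD ↦ h ?_⟩, hP⟩
        exact mem_of_le hD hjD le_rfl le_rfl (by omega) (by omega)
    · rintro (⟨⟨hD, -⟩, hP⟩ | ⟨hD, -, hP⟩) <;> exact ⟨hD, hP⟩
  · rw [Set.disjoint_left]
    rintro D ⟨hD, -⟩ ⟨-, h, -⟩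
    have := hD.1 _ _ h
    omega

/-- To the right of the middle column the number of filters is a power of two. -/
theorem ncard_right (hx : n + 1 ≤ x) : (rootFilters n i x).ncard = 2 ^ (2 * n + 2 - i - x) := by
  generalize hd : 2 * n + 2 - i - x = d
  induction d generalizing i x with
  | zero => rw [eq_of_antidiagonal_le (by omega)]; simp
  | succ d ih =>
    -- Right of the middle column the constraint `k < y` is automatic, so each step of the path up
    -- to the antidiagonal is a free binary choice.
    have h := ncard_split (i := i) (x := x) (n := n) (by omega) (by omega) (fun _ ↦ True)
    simp only [and_true, Set.ofPred_mem_eq] at h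
    rw [h, ih (by omega) (by omega), ih hx (by omega), pow_succ]
    omega

/-- Lattice paths through a rectangle: Pascal's rule inside, a constant value on the side `i = i₁`,
and a forced path along the side `x = x₁`. -/
theorem _root_.eq_choose_mul_of_pascal {i₁ x₁ c : ℕ} (F : ℕ → ℕ → ℕ)
    (h0 : ∀ x ≤ x₁, F i₁ x = c) (h1 : ∀ i < i₁, F i x₁ = F (i + 1) x₁)
    (h2 : ∀ i < i₁, ∀ x < x₁, F i x = F i (x + 1) + F (i + 1) x) {i x : ℕ} (hi : i ≤ i₁)
    (hx : x ≤ x₁) : F i x = (x₁ - x + (i₁ - i)).choose (i₁ - i) * c := by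
  suffices h : ∀ p ≤ i₁, ∀ q ≤ x₁, F (i₁ - p) (x₁ - q) = (q + p).choose p * c by
    have := h (i₁ - i) (by omega) (x₁ - x) (by omega)
    rwa [Nat.sub_sub_self hi, Nat.sub_sub_self hx] at this
  intro p
  induction p with
  | zero => intro _ q hq; simpa using h0 (x₁ - q) (by omega)
  | succ p ihp =>
    intro hp q
    induction q with
    | zero =>
      intro _
      have := ihp (by omega) 0 (by omega)
      rw [show i₁ - p = i₁ - (p + 1) + 1 by omega] at this
      simpa [← h1 _ (show i₁ - (p + 1) < i₁ by omega)] using this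
    | succ q ihq =>
      intro hq
      rw [h2 _ (by omega) _ (by omega), show x₁ - (q + 1) + 1 = x₁ - q by omega,
        show i₁ - (p + 1) + 1 = i₁ - p by omega, ihq (by omega), ihp (by omega) _ hq, ← add_mul,
        show q + 1 + (p + 1) = (q + (p + 1)) + 1 by omega, Nat.choose_succ_succ',
        show q + 1 + p = q + (p + 1) by omega, add_comm ((q + (p + 1)).choose p)]

theorem rowGap_union_rowFrom {a y k z : ℕ} (hk : k ≠ a) :
    RowGap (D ∪ rowFrom n k z) a y ↔ RowGap D a y := by
  have : ∀ j, (a, j) ∉ rowFrom n k z := fun j h ↦ hk h.1.symm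
  simp [RowGap, this]

theorem mem_union_rowFrom {a y k z : ℕ} (hk : k ≠ a) :
    (a, y) ∈ D ∪ rowFrom n k z ↔ (a, y) ∈ D := by
  have : (a, y) ∉ rowFrom n k z := fun h ↦ hk h.1.symm
  simp [this]

/-- Filters in which row `a` starts exactly in column `b`. -/
theorem ncard_rowStart {a b : ℕ} (hi : i ≤ a) (hax : a < x) (hxb : x ≤ b) (hab : a + b ≤ 2 * n + 1)
    (Q : Set (ℕ × ℕ) → Prop) (hQ : ∀ D k, i ≤ k → k ≤ a → ∀ z, Q (D ∪ rowFrom n k z) ↔ Q D) :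
    {D ∈ rootFilters n i x | RowGap D a b ∧ (a, b) ∈ D ∧ Q D}.ncard =
      (b - x + (a - i)).choose (a - i) * {D ∈ rootFilters n (a + 1) b | Q D}.ncard := by
  -- By `a < x` and `a + b ≤ 2 * n + 1` the rectangle of rows `i, …, a - 1` and columns `x, …, b -
  -- 1` stays off the diagonal and the antidiagonal, so the path crosses it freely; `hQ` lets `Q`
  -- ignore the full rows split off on the way.
  have key := eq_choose_mul_of_pascal (i₁ := a - i) (x₁ := b - x)
    (c := {D ∈ rootFilters n (a + 1) b | Q D}.ncard)
    (fun i' x' ↦ {D ∈ rootFilters n (i + i') (x + x') |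
      RowGap D a b ∧ (a, b) ∈ D ∧ Q D}.ncard) ?_ ?_ ?_ (i := 0) (x := 0) (by omega) (by omega)
  · simpa using key
  · intro y hy
    rw [show i + (a - i) = a by omega]
    have : {D ∈ rootFilters n a (x + y) | RowGap D a b ∧ (a, b) ∈ D ∧ Q D} =
        {D ∈ rootFilters n a b | (a, b) ∈ D ∧ Q D} := by
      ext D
      simp only [Set.mem_ofPred_eq]
      rw [← rowGap_iff (show x + y ≤ b by omega)]
      tauto
    rw [this, ncard_mem_corner (by omega) hab]
    simp only [hQ _ _ hi le_rfl]
  · intro p hp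
    rw [ncard_split (by omega) (by omega)]
    have : {D ∈ rootFilters n (i + p) (x + (b - x) + 1) | RowGap D a b ∧ (a, b) ∈ D ∧ Q D} = ∅ := by
      ext D
      simp only [Set.mem_ofPred_eq, Set.mem_empty_iff_false, iff_false]
      rintro ⟨hD, -, h, -⟩
      have := hD.1 _ _ h
      omega
    rw [this]
    simp [rowGap_union_rowFrom (show i + p ≠ a by omega),
      mem_union_rowFrom (show i + p ≠ a by omega), hQ _ _ (show i ≤ i + p by omega) (show i + p ≤ a by omega), add_assoc]
  · intro p hp y hy
    rw [ncard_split (by omega) (by omega)]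
    simp [rowGap_union_rowFrom (show i + p ≠ a by omega),
      mem_union_rowFrom (show i + p ≠ a by omega), hQ _ _ (show i ≤ i + p by omega) (show i + p ≤ a by omega), add_assoc]

/-- Filters whose boundary passes from column `y` to column `y + 1` in row `r`. -/
theorem ncard_colStart {r y : ℕ} (hi : i ≤ r) (hrx : r ≤ x) (hxy : x ≤ y)
    (hry : r + y ≤ 2 * n + 2) :
    {D ∈ rootFilters n i x | (i < r → (r - 1, y) ∈ D) ∧ RowGap D r (y + 1)}.ncard =
      (y - x + (r - i)).choose (r - i) * (rootFilters n r (y + 1)).ncard := by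
  have key := eq_choose_mul_of_pascal (i₁ := r - i) (x₁ := y - x)
    (c := (rootFilters n r (y + 1)).ncard)
    (fun i' x' ↦ {D ∈ rootFilters n (i + i') (x + x') |
      (i + i' < r → (r - 1, y) ∈ D) ∧ RowGap D r (y + 1)}.ncard) ?_ ?_ ?_
      (i := 0) (x := 0) (by omega) (by omega)
  · simpa using key
  · intro z hz
    rw [show i + (r - i) = r by omega]
    congr 1
    ext D
    simp only [Set.mem_ofPred_eq]
    rw [← rowGap_iff (show x + z ≤ y + 1 by omega)]
    simp
  · intro p hp
    have hr : i + p < r := by omega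
    have hxy' : x + (y - x) = y := by omega
    rw [ncard_split (by omega) (by omega)]
    have : {D ∈ rootFilters n (i + p) (x + (y - x) + 1) |
        (i + p < r → (r - 1, y) ∈ D) ∧ RowGap D r (y + 1)} = ∅ := by
      ext D
      simp only [Set.mem_ofPred_eq, Set.mem_empty_iff_false, iff_false]
      rintro ⟨hD, h, -⟩
      have := hD.1 _ _ (h hr)
      omega
    rw [this]
    simp only [rowGap_union_rowFrom (show i + p ≠ r by omega), Set.ncard_empty, zero_add, add_assoc]
    congr 1
    ext D
    simp only [Set.mem_ofPred_eq, and_congr_right_iff]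
    intro hD
    refine and_congr_left fun _ ↦ ?_
    by_cases h : i + (p + 1) < r
    · simp [mem_union_rowFrom (show i + p ≠ r - 1 by omega), h, hr]
    -- Here `i + p = r - 1`, so the required cell lies in the full row just split off.
    · simp only [hr, true_imp_iff, h, false_imp_iff, iff_true]
      exact Or.inr (mem_rowFrom.2 (by omega))
  · intro p hp z hz
    have hr : i + p < r := by omega
    rw [ncard_split (by omega) (by omega)]
    simp only [rowGap_union_rowFrom (show i + p ≠ r by omega), add_assoc]
    congr 2
    ext D
    simp only [Set.mem_ofPred_eq, and_congr_right_iff]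
    intro hD
    refine and_congr_left fun _ ↦ ?_
    by_cases h : i + (p + 1) < r
    · simp [mem_union_rowFrom (show i + p ≠ r - 1 by omega), h, hr]
    · simp only [hr, true_imp_iff, h, false_imp_iff, iff_true]
      exact Or.inr (mem_rowFrom.2 (by omega))

end rootFilters

/-! ### Folding along the antidiagonal, and filters without chains -/

/-- The pair `(i, j)` or its mirror image `(2n + 2 - j, 2n + 2 - i)` lies in `D`. -/
def FoldMem (n : ℕ) (D : Set (ℕ × ℕ)) (i j : ℕ) : Prop :=
  (i + j < 2 * n + 2 ∧ (i, j) ∈ D) ∨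
    (2 * n + 2 < i + j ∧ (2 * n + 2 - j, 2 * n + 2 - i) ∈ D)

theorem exists_rowStart {D : Set (ℕ × ℕ)} {i y : ℕ} (h : ¬ RowGap D i y) :
    ∃ a < y, RowGap D i a ∧ (i, a) ∈ D := by
  classical
  have h' : ∃ a, a < y ∧ (i, a) ∈ D := by simpa [RowGap] using h
  exact ⟨Nat.find h', (Nat.find_spec h').1, fun j hj hjD ↦
    Nat.find_min h' hj ⟨hj.trans (Nat.find_spec h').1, hjD⟩, (Nat.find_spec h').2⟩

theorem RowGap.le {D : Set (ℕ × ℕ)} {i y j : ℕ} (h : RowGap D i y) (hj : (i, j) ∈ D) : y ≤ j := by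
  by_contra hlt
  exact h j (by omega) hj

theorem rowStart_unique {D : Set (ℕ × ℕ)} {i y z : ℕ} (h : RowGap D i y) (hy : (i, y) ∈ D)
    (h' : RowGap D i z) (hz : (i, z) ∈ D) : y = z :=
  le_antisymm (h.le hz) (h'.le hy)

namespace rootFilters

variable {n i x : ℕ} {D : Set (ℕ × ℕ)}

theorem foldMem_bounds (hD : D ∈ rootFilters n 1 2) {i j : ℕ} (h : FoldMem n D i j) :
    1 ≤ i ∧ i < j ∧ j ≤ 2 * n + 1 := by
  rcases h with ⟨h, h'⟩ | ⟨h, h'⟩ <;> have := hD.1 _ _ h' <;> omega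

/-- The mirror exchanges moving right with moving up, so the folded set is again upward closed,
except on the antidiagonal, where `FoldMem` is false. -/
theorem foldMem_mono (hD : D ∈ rootFilters n 1 2) {i j i' j' : ℕ} (h : FoldMem n D i j)
    (hi : 1 ≤ i') (hi' : i' ≤ i) (hj : j ≤ j') (hj' : j' ≤ 2 * n + 1) (hne : i' + j' ≠ 2 * n + 2) :
    FoldMem n D i' j' := by
  have hb := foldMem_bounds hD h
  rcases h with ⟨h, h'⟩ | ⟨h, h'⟩ <;> rcases hne.lt_or_gt with hlt | hlt
  · exact Or.inl ⟨hlt, mem_of_le hD h' hi hi' hj (by omega)⟩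
  · exact Or.inr ⟨hlt, mem_of_le hD h' (by omega) (by omega) (by omega) (by omega)⟩
  · exact Or.inl ⟨hlt, mem_of_le hD h' (by omega) (by omega) (by omega) (by omega)⟩
  · exact Or.inr ⟨hlt, mem_of_le hD h' (by omega) (by omega) (by omega) (by omega)⟩

theorem foldMem_mirror (hD : D ∈ rootFilters n 1 2) {i j : ℕ} (h : FoldMem n D i j) :
    FoldMem n D (2 * n + 2 - j) (2 * n + 2 - i) := by
  have hb := foldMem_bounds hD h
  rcases h with ⟨h, h'⟩ | ⟨h, h'⟩
  · refine Or.inr ⟨by omega, ?_⟩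
    rwa [Nat.sub_sub_self (by omega), Nat.sub_sub_self (by omega)]
  · exact Or.inl ⟨by omega, h'⟩

theorem foldMem_of_mem (hD : D ∈ rootFilters n 1 2) {i j : ℕ} (h : (i, j) ∈ D) :
    FoldMem n D i j :=
  Or.inl ⟨by have := hD.1 _ _ h; omega, h⟩

theorem foldMem_iff_mem {i j : ℕ} (hij : i + j < 2 * n + 2) : FoldMem n D i j ↔ (i, j) ∈ D := by
  constructor
  · rintro (⟨-, h⟩ | ⟨h, -⟩)
    · exact h
    · omega
  · exact fun h ↦ Or.inl ⟨hij, h⟩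

theorem foldMem_one_iff (hD : D ∈ rootFilters n 1 2) {a : ℕ} : FoldMem n D 1 a ↔ (1, a) ∈ D := by
  constructor
  · intro h
    have hb := foldMem_bounds hD h
    rcases h with h | ⟨h, -⟩
    · exact h.2
    · omega
  · exact foldMem_of_mem hD

theorem foldMem_last_iff (hD : D ∈ rootFilters n 1 2) {c : ℕ} (hc : 2 ≤ c) :
    FoldMem n D c (2 * n) ↔ c ≤ 2 * n ∧ (2, 2 * n + 2 - c) ∈ D := by
  constructor
  · intro h
    have hb := foldMem_bounds hD h
    have hne : c ≠ 2 := by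
      rintro rfl
      rcases h with h | h <;> omega
    have := foldMem_mirror hD h
    rw [show 2 * n + 2 - 2 * n = 2 by omega, foldMem_iff_mem (by omega)] at this
    exact ⟨by omega, this⟩
  · rintro ⟨hc, h⟩
    have := hD.1 _ _ h
    have := foldMem_mirror hD (foldMem_of_mem hD h)
    rwa [Nat.sub_sub_self (by omega), show 2 * n + 2 - 2 = 2 * n by omega] at this

/-- The column analogue of `exists_rowStart`: `r` is the first row from `i₀` on without entries up
to column `y`, hence the row above it, if any, contains `y`. -/
theorem exists_colStart {i₀ a y : ℕ} (hD : D ∈ rootFilters n i x) (hi : i ≤ i₀) (ha : i₀ ≤ a)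
    (hg : RowGap D a (y + 1)) (hay : a + y ≤ 2 * n + 2) :
    ∃ r, i₀ ≤ r ∧ r ≤ a ∧ (i₀ < r → (r - 1, y) ∈ D) ∧ RowGap D r (y + 1) := by
  classical
  have h : ∃ r, i₀ ≤ r ∧ RowGap D r (y + 1) := ⟨a, ha, hg⟩
  have hle : Nat.find h ≤ a := Nat.find_min' h ⟨ha, hg⟩
  refine ⟨Nat.find h, (Nat.find_spec h).1, hle, fun hlt ↦ ?_, (Nat.find_spec h).2⟩
  have := Nat.find_min h (m := Nat.find h - 1) (by omega)
  rw [not_and] at this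
  obtain ⟨j, hj, -, hjD⟩ := exists_rowStart (this (by omega))
  exact mem_of_le hD hjD (by omega) le_rfl (by omega) (by omega)

theorem colStart_unique {i₀ r r' y : ℕ} (hD : D ∈ rootFilters n i x) (hi : i ≤ i₀) (hr : i₀ ≤ r)
    (hr' : i₀ ≤ r') (h1 : i₀ < r → (r - 1, y) ∈ D) (h2 : RowGap D r (y + 1))
    (h1' : i₀ < r' → (r' - 1, y) ∈ D) (h2' : RowGap D r' (y + 1)) : r = r' := by
  have aux : ∀ {s t : ℕ}, i₀ ≤ s → (i₀ < t → (t - 1, y) ∈ D) → RowGap D s (y + 1) → ¬ s < t := by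
    intro s t hs ht hg hst
    have h := ht (by omega)
    have hb := hD.1 _ _ h
    exact hg y (by omega) (mem_of_le hD h (by omega) (by omega) le_rfl (by omega))
  have := aux hr h1' h2
  have := aux hr' h1 h2'
  omega

/-- By the mirror, the last link from `b` to `2 * n` says that `(2, 2 * n + 2 - b)` is a cell. It is
enough to test the first column `a` of row 1 and the first column of row `a`. In the second
alternative row `a` is empty, as its columns end at `2 * n + 1 - a`. -/
theorem not_exists_three_chain_iff (hD : D ∈ rootFilters n 1 2) :
    (¬ ∃ a b, FoldMem n D 1 a ∧ FoldMem n D a b ∧ FoldMem n D b (2 * n)) ↔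
      RowGap D 1 (n + 1) ∨
      (∃ a, 2 ≤ a ∧ a ≤ n ∧ RowGap D 1 a ∧ (1, a) ∈ D ∧ RowGap D a (2 * n + 2 - a)) ∨
      (∃ a c, 2 ≤ a ∧ a < c ∧ c ≤ n ∧ RowGap D 1 a ∧ (1, a) ∈ D ∧ RowGap D a (2 * n + 2 - c) ∧
        (a, 2 * n + 2 - c) ∈ D ∧ RowGap D 2 (c + 1)) := by
  have hfold : (∃ a b, FoldMem n D 1 a ∧ FoldMem n D a b ∧ FoldMem n D b (2 * n)) ↔
      ∃ a b, (1, a) ∈ D ∧ FoldMem n D a b ∧ b ≤ 2 * n ∧ (2, 2 * n + 2 - b) ∈ D := by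
    refine exists_congr fun a ↦ exists_congr fun b ↦ ?_
    rw [foldMem_one_iff hD]
    refine and_congr_right fun h1 ↦ and_congr_right fun h2 ↦ foldMem_last_iff hD ?_
    have := hD.1 _ _ h1
    have := foldMem_bounds hD h2
    omega
  rw [hfold]
  constructor
  · intro hno
    by_cases h1 : RowGap D 1 (n + 1)
    · exact Or.inl h1
    right
    obtain ⟨a, han, hga, ha⟩ := exists_rowStart h1
    have hab := hD.1 _ _ ha
    by_cases h2 : RowGap D a (2 * n + 2 - a)
    · exact Or.inl ⟨a, by omega, by omega, hga, ha, h2⟩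
    right
    obtain ⟨b, hba, hgb, hb⟩ := exists_rowStart h2
    have hbb := hD.1 _ _ hb
    -- Otherwise 1, `a`, `n + 1`, `2 * n` is a chain: its last link mirrors `(2, n + 1)`, which is a
    -- cell because `(a, n + 1)` is.
    have hbn : n + 2 ≤ b := by
      by_contra hlt
      refine hno ⟨a, n + 1, ha, foldMem_of_mem hD
        (mem_of_le hD hb (by omega) le_rfl (by omega) (by omega)), by omega, ?_⟩
      exact mem_of_le hD hb (by omega) (by omega) (by omega) (by omega)
    refine ⟨a, 2 * n + 2 - b, by omega, by omega, by omega, hga, ha, ?_, ?_, ?_⟩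
    · rwa [Nat.sub_sub_self (by omega)]
    · rwa [Nat.sub_sub_self (by omega)]
    · intro j hj hjD
      exact hno ⟨a, b, ha, foldMem_of_mem hD hb, by omega,
        mem_of_le hD hjD (by omega) le_rfl (by omega) (by omega)⟩
  · rintro h ⟨a, b, ha, hab, hbn, hb⟩
    have h2a := hD.1 _ _ ha
    have h2b := hD.1 _ _ hb
    have hb' := foldMem_bounds hD hab
    rcases h with h | ⟨a₀, h1, h2, h3, h4, h5⟩ | ⟨a₀, c, h1, h2, h3, h4, h5, h6, h7, h8⟩
    · have := h.le ha
      have := h.le (mem_of_le hD hb le_rfl (by omega) le_rfl (by omega))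
      omega
    · have h6 := h3.le ha
      have h7 := h3.le (mem_of_le hD hb le_rfl (by omega) le_rfl (by omega))
      -- If `(a₀, b)` lies on the antidiagonal, monotonicity does not apply; then the mirror of the
      -- link from `a` to `b` lies in row `a₀`.
      have h8 : FoldMem n D a₀ b ∨ a₀ + b = 2 * n + 2 := by
        by_cases he : a₀ + b = 2 * n + 2
        · exact Or.inr he
        · exact Or.inl (foldMem_mono hD hab (by omega) h6 le_rfl (by omega) he)
      rcases h8 with h8 | h8
      · rw [foldMem_iff_mem (by
          rcases h8 with h8 | h8
          · exact h8.1
          · omega)] at h8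
        have := h5.le h8
        have := hD.1 _ _ h8
        omega
      · have h9 := foldMem_mirror hD hab
        rw [show 2 * n + 2 - b = a₀ by omega] at h9
        have hne : a ≠ a₀ := by
          rintro rfl
          rcases hab with hab | hab <;> omega
        rw [foldMem_iff_mem (by omega)] at h9
        have := h5.le h9
        omega
    · have h9 := h4.le ha
      have h10 : 2 * n + 2 - c ≤ b := by
        by_contra hlt
        have := foldMem_mono hD hab (by omega) h9 le_rfl (by omega) (by omega)
        rw [foldMem_iff_mem (by omega)] at this
        have := h6.le this
        omega
      have := h8.le hb
      omega

/-- Mirroring the last two links splits a chain into the half-chains 1, `a`, `b` and 2, `u`, `2 * n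
+ 2 - b`. One of `b` and `2 * n + 2 - b` is at most `n + 1`, so without a pair of links 1, `a`, `n +
1` there is no chain. Otherwise the least `a` and `b` decide: `r` is the first row after `a` that
does not reach column `2 * n + 2 - b`, and row 2 must not start before `r`. -/
theorem not_exists_four_chain_iff (hD : D ∈ rootFilters n 1 2) :
    (¬ ∃ a b c, FoldMem n D 1 a ∧ FoldMem n D a b ∧ FoldMem n D b c ∧ FoldMem n D c (2 * n)) ↔
      (¬ ∃ a ≤ n, (1, a) ∈ D ∧ (a, n + 1) ∈ D) ∨
      (∃ a b r, 2 ≤ a ∧ a < r ∧ r ≤ b ∧ b ≤ n + 1 ∧ RowGap D 1 a ∧ (1, a) ∈ D ∧ RowGap D 2 r ∧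
        RowGap D a b ∧ (a, b) ∈ D ∧ (a + 1 < r → (r - 1, 2 * n + 2 - b) ∈ D) ∧
        RowGap D r (2 * n + 2 - b + 1)) := by
  have hfold : (∃ a b c, FoldMem n D 1 a ∧ FoldMem n D a b ∧ FoldMem n D b c ∧
      FoldMem n D c (2 * n)) ↔
      ∃ a b u, (1, a) ∈ D ∧ FoldMem n D a b ∧ FoldMem n D u (2 * n + 2 - b) ∧ (2, u) ∈ D := by
    constructor
    · rintro ⟨a, b, c, h1, h2, h3, h4⟩
      rw [foldMem_one_iff hD] at h1
      have hb := foldMem_bounds hD h2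
      have hb' := foldMem_bounds hD h3
      rw [foldMem_last_iff hD (by omega)] at h4
      exact ⟨a, b, 2 * n + 2 - c, h1, h2, foldMem_mirror hD h3, h4.2⟩
    · rintro ⟨a, b, u, h1, h2, h3, h4⟩
      have hb := foldMem_bounds hD h2
      have hu := foldMem_bounds hD h3
      have h2u := hD.1 _ _ h4
      refine ⟨a, b, 2 * n + 2 - u, foldMem_of_mem hD h1, h2, ?_, ?_⟩
      · have := foldMem_mirror hD h3
        rwa [Nat.sub_sub_self (by omega)] at this
      · rw [foldMem_last_iff hD (by omega), Nat.sub_sub_self (by omega)]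
        exact ⟨by omega, h4⟩
  rw [hfold]
  constructor
  · intro hno
    refine or_iff_not_imp_left.2 fun hA ↦ ?_
    rw [not_not] at hA
    obtain ⟨a', ha'n, ha', ha'm⟩ := hA
    obtain ⟨a, haa', hga, ha⟩ := exists_rowStart (D := D) (i := 1) (y := a' + 1)
      (fun h ↦ h a' (by omega) ha')
    have hab := hD.1 _ _ ha
    have ham : (a, n + 1) ∈ D := mem_of_le hD ha'm (by omega) (by omega) le_rfl (by omega)
    obtain ⟨b, hbn, hgb, hb⟩ := exists_rowStart (D := D) (i := a) (y := n + 2)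
      (fun h ↦ h (n + 1) (by omega) ham)
    have hbb := hD.1 _ _ hb
    -- Row `b` is empty, which gives `r ≤ b`: a cell in it would yield `(b, 2 * n + 1 - b)` and a
    -- chain through `a` and `b + 1` with `u = b`.
    obtain ⟨r, hr, hrn, hr1, hr2⟩ := exists_colStart (a := b) (i₀ := a + 1) (y := 2 * n + 2 - b)
      hD (by omega) (by omega) (fun j hj h ↦ by
        have hj' := hD.1 _ _ h
        have h1 : (b, 2 * n + 1 - b) ∈ D := mem_of_le hD h (by omega) le_rfl (by omega) (by omega)
        refine hno ⟨a, b + 1, b, ha, ?_, ?_, ?_⟩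
        · exact foldMem_of_mem hD (mem_of_le hD hb (by omega) le_rfl (by omega) (by omega))
        · rw [show 2 * n + 2 - (b + 1) = 2 * n + 1 - b by omega]
          exact foldMem_of_mem hD h1
        · exact mem_of_le hD hb (by omega) (by omega) (by omega) (by omega)) (by omega)
    refine ⟨a, b, r, by omega, by omega, hrn, by omega, hga, ha, fun j hj hjD ↦ ?_, hgb, hb, hr1,
      hr2⟩
    have hjb := hD.1 _ _ hjD
    -- If row 2 reaches column `a`, both half-chains pass through `a` and meet at `n + 1`; otherwise
    -- row `j` lies above row `r` and reaches column `2 * n + 2 - b`.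
    by_cases hja : j ≤ a
    · refine hno ⟨a, n + 1, a, ha, foldMem_of_mem hD ham, ?_, ?_⟩
      · rw [show 2 * n + 2 - (n + 1) = n + 1 by omega]
        exact foldMem_of_mem hD ham
      · exact mem_of_le hD hjD (by omega) le_rfl (by omega) (by omega)
    · have h1 := hr1 (by omega)
      have h2 := hD.1 _ _ h1
      have h3 : (j, 2 * n + 2 - b) ∈ D :=
        mem_of_le hD h1 (by omega) (by omega) le_rfl (by omega)
      refine hno ⟨a, b, j, ha, foldMem_of_mem hD hb, foldMem_of_mem hD h3, hjD⟩
  · rintro h ⟨a, b, u, h1, h2, h3, h4⟩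
    have hb1 := hD.1 _ _ h1
    have hb2 := foldMem_bounds hD h2
    have hb3 := foldMem_bounds hD h3
    have hb4 := hD.1 _ _ h4
    rcases h with h | ⟨a₀, b₀, r, g1, g2, g3, g4, g5, g6, g7, g8, g9, g10, g11⟩
    · by_cases hbn : b ≤ n + 1
      · rw [foldMem_iff_mem (by omega)] at h2
        exact h ⟨a, by omega, h1, mem_of_le hD h2 (by omega) le_rfl (by omega) (by omega)⟩
      · rw [foldMem_iff_mem (by omega)] at h3
        exact h ⟨u, by omega, mem_of_le hD h4 le_rfl (by omega) le_rfl (by omega),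
          mem_of_le hD h3 (by omega) le_rfl (by omega) (by omega)⟩
    · have ha := g5.le h1
      have hu := g7.le h4
      have hb : b₀ ≤ b := by
        by_contra hlt
        have := foldMem_mono hD h2 (by omega) ha le_rfl (by omega) (by omega)
        rw [foldMem_iff_mem (by omega)] at this
        have := g8.le this
        omega
      -- For `r = b` the pair `(r, 2 * n + 2 - b)` is on the antidiagonal, and the mirror of the
      -- link starting at `u` is used, which lies in row `r`.
      by_cases hrb : r = b
      · subst hrb
        have h5 := foldMem_mirror hD h3
        rw [Nat.sub_sub_self (by omega)] at h5
        have hne : r ≠ u := by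
          rintro rfl
          rcases h3 with h3 | h3 <;> omega
        rw [foldMem_iff_mem (by omega)] at h5
        have := g11.le h5
        omega
      · have h5 := foldMem_mono hD h3 (by omega) hu le_rfl (by omega) (by omega)
        rw [foldMem_iff_mem (by omega)] at h5
        have := g11.le h5
        omega

end rootFilters

/-! ### Counting the filters of a single alternative -/

open Finset in
theorem Set.ncard_sep_exists_eq_sum {α ι : Type*} {S : Set α} (hS : S.Finite) (T : Finset ι)
    (Q : ι → α → Prop)
    (hQ : ∀ a ∈ S, ∀ p ∈ T, ∀ q ∈ T, Q p a → Q q a → p = q) :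
    {a ∈ S | ∃ p ∈ T, Q p a}.ncard = ∑ p ∈ T, {a ∈ S | Q p a}.ncard := by
  classical
  have hfin : ∀ p, {a ∈ S | Q p a}.Finite := fun p ↦ hS.subset fun a h ↦ h.1
  have h : {a ∈ S | ∃ p ∈ T, Q p a} = (T.biUnion fun p ↦ (hfin p).toFinset : Finset α) := by
    ext a
    simp
  rw [h, Set.ncard_coe_finset, card_biUnion]
  · exact sum_congr rfl fun p _ ↦ (Set.ncard_eq_toFinset_card _ (hfin p)).symm
  · intro p hp q hq hpq
    change Disjoint (hfin p).toFinset (hfin q).toFinset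
    rw [Finset.disjoint_left]
    intro a ha ha'
    simp only [Set.Finite.mem_toFinset, Set.mem_ofPred_eq] at ha ha'
    exact hpq (hQ a ha.1 p hp q hq ha.2 ha'.2)

theorem Set.ncard_sep_or {α : Type*} {S : Set α} (hS : S.Finite) (P Q : α → Prop)
    (h : ∀ a ∈ S, P a → ¬ Q a) :
    {a ∈ S | P a ∨ Q a}.ncard = {a ∈ S | P a}.ncard + {a ∈ S | Q a}.ncard := by
  rw [← Set.ncard_union_eq _ (hS.subset fun a h ↦ h.1) (hS.subset fun a h ↦ h.1)]
  · congr 1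
    ext a
    simp only [Set.mem_ofPred_eq, Set.mem_union]
    tauto
  · rw [Set.disjoint_left]
    exact fun a ha ha' ↦ h a ha.1 ha.2 ha'.2

namespace rootFilters

open Finset

variable {n i x : ℕ} {D : Set (ℕ × ℕ)}

theorem sep_rowGap {y : ℕ} (hxy : x ≤ y) (P : Set (ℕ × ℕ) → Prop) :
    {D ∈ rootFilters n i x | RowGap D i y ∧ P D} = {D ∈ rootFilters n i y | P D} := by
  ext D
  simp only [Set.mem_ofPred_eq]
  rw [← rowGap_iff hxy, and_assoc]

theorem ncard_firstRow_gap (hn : 1 ≤ n) :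
    {D ∈ rootFilters n 1 2 | RowGap D 1 (n + 1)}.ncard = 2 ^ n := by
  have := sep_rowGap (n := n) (i := 1) (show 2 ≤ n + 1 by omega) (fun _ ↦ True)
  simp only [and_true, Set.ofPred_mem_eq] at this
  rw [this, ncard_right le_rfl]
  congr 1
  omega

theorem ncard_firstRow_start {a : ℕ} (ha : 2 ≤ a) (han : a ≤ n) (Q : Set (ℕ × ℕ) → Prop)
    (hQ : ∀ D z, Q (D ∪ rowFrom n 1 z) ↔ Q D) :
    {D ∈ rootFilters n 1 2 | RowGap D 1 a ∧ (1, a) ∈ D ∧ Q D}.ncard =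
      {D ∈ rootFilters n 2 a | Q D}.ncard := by
  rw [ncard_rowStart le_rfl (by omega) ha (by omega) Q
    (fun D k hk hk' z ↦ by obtain rfl : k = 1 := by omega
                           exact hQ D z)]
  simp

/-- The pairs of nested antidiagonals: they index the triples of natural numbers with sum `N`. -/
def tripleIndex (N : ℕ) : Finset (Σ _ : ℕ × ℕ, ℕ × ℕ) :=
  (antidiagonal N).sigma fun q ↦ antidiagonal q.2

theorem mem_tripleIndex {N s t m k : ℕ} :
    (⟨(s, t), (m, k)⟩ : Σ _ : ℕ × ℕ, ℕ × ℕ) ∈ tripleIndex N ↔ s + t = N ∧ m + k = t := by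
  simp [tripleIndex]

/-- With `a` the first column of row 1, the parameters are `k + 2` for the crossing row, `s = a - (k
+ 2)` and `m = n - a`. Once row 1 is split off, a path up to the crossing and a free tail remain. -/
theorem ncard_colStart_of_rowStart {s m k y : ℕ} (hn : n = k + s + m + 2) (hy : k + s + 2 ≤ y)
    (hny : n ≤ y) (hy' : k + y ≤ 2 * n) :
    {D ∈ rootFilters n 1 2 | RowGap D 1 (k + s + 2) ∧ (1, k + s + 2) ∈ D ∧
      (2 < k + 2 → (k + 2 - 1, y) ∈ D) ∧ RowGap D (k + 2) (y + 1)}.ncard =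
      (y - (k + s + 2) + k).choose k * 2 ^ (2 * n + 2 - (k + 2) - (y + 1)) := by
  rw [ncard_firstRow_start (by omega) (by omega), ncard_colStart (by omega) (by omega) hy
    (by omega), ncard_right (by omega)]
  · rfl
  · intro D z
    rw [rowGap_union_rowFrom (by omega)]
    refine and_congr_left fun _ ↦ imp_congr_right fun h ↦ ?_
    rw [mem_union_rowFrom (by omega)]

/-- In the third alternative for three links, `k = a - 2`, `d = c - a - 1` and `m = n - c`. -/
theorem ncard_secondRow_start {m d k : ℕ} (hn : n = k + d + m + 3) :
    {D ∈ rootFilters n 1 2 | RowGap D 1 (k + 2) ∧ (1, k + 2) ∈ D ∧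
      RowGap D (k + 2) (k + d + 2 * m + 5) ∧ (k + 2, k + d + 2 * m + 5) ∈ D ∧
      RowGap D 2 (k + d + 4)}.ncard = (2 * m + 1 + k).choose k * 2 ^ d := by
  rw [ncard_firstRow_start (by omega) (by omega)]
  · have h := sep_rowGap (n := n) (i := 2) (show k + 2 ≤ k + d + 4 by omega) (fun D ↦
      RowGap D (k + 2) (k + d + 2 * m + 5) ∧ (k + 2, k + d + 2 * m + 5) ∈ D ∧ True)
    have h' := ncard_rowStart (n := n) (i := 2) (x := k + d + 4) (a := k + 2)
      (b := k + d + 2 * m + 5) (by omega) (by omega) (by omega) (by omega) (fun _ ↦ True) (by simp)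
    rw [← h] at h'
    simp only [and_true, Set.ofPred_mem_eq] at h'
    rw [ncard_right (by omega)] at h'
    rw [show k + d + 2 * m + 5 - (k + d + 4) + (k + 2 - 2) = 2 * m + 1 + k by omega,
      Nat.add_sub_cancel,
      show 2 * n + 2 - (k + 2 + 1) - (k + d + 2 * m + 5) = d by omega] at h'
    rw [← h']
    congr 1
    ext D
    simp only [Set.mem_ofPred_eq]
    tauto
  · intro D z
    rw [rowGap_union_rowFrom (by omega), rowGap_union_rowFrom (by omega),
      mem_union_rowFrom (by omega)]

/-- In the second alternative for four links, `k = a - 2`, `l = r - a - 1`, `s = b - r` and `m = n +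
1 - b`. The binomials belong to the rows between 1 and `a` and between `a` and `r`. For `s = 0` the
tail region is empty, and the truncated `s - 1` correctly gives one filter. -/
theorem ncard_short_type {k l s m : ℕ} (hn : n = k + l + s + m + 2) :
    {D ∈ rootFilters n 1 2 | RowGap D 1 (k + 2) ∧ (1, k + 2) ∈ D ∧ RowGap D 2 (k + l + 3) ∧
      RowGap D (k + 2) (k + l + s + 3) ∧ (k + 2, k + l + s + 3) ∈ D ∧
      (k + 2 + 1 < k + l + 3 → (k + l + 3 - 1, k + l + s + 2 * m + 3) ∈ D) ∧
        RowGap D (k + l + 3) (k + l + s + 2 * m + 3 + 1)}.ncard =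
      (s + k).choose k * ((2 * m + l).choose l * 2 ^ (s - 1)) := by
  rw [ncard_firstRow_start (by omega) (by omega), sep_rowGap (by omega), ncard_rowStart (by omega)
    (by omega) (by omega) (by omega), ncard_colStart (by omega) (by omega) (by omega) (by omega),
    ncard_right (by omega)]
  · congr 2
    · omega
    · congr 1 <;> omega
    · congr 1; omega
  · intro D p hp hp' z
    rw [rowGap_union_rowFrom (by omega)]
    refine and_congr_left fun _ ↦ imp_congr_right fun h ↦ ?_
    rw [mem_union_rowFrom (by omega)]
  · intro D z
    rw [rowGap_union_rowFrom (by omega), rowGap_union_rowFrom (by omega),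
      rowGap_union_rowFrom (by omega), mem_union_rowFrom (by omega)]
    refine and_congr_right fun _ ↦ and_congr_right fun _ ↦ and_congr_right fun _ ↦
      and_congr_left fun _ ↦ imp_congr_right fun h ↦ ?_
    rw [mem_union_rowFrom (by omega)]

end rootFilters

/-! ### Sums of binomial coefficients, powers and Fibonacci numbers -/

section Sums

open Finset

/-- These are the shallow diagonals of Pascal's triangle; the entries not hit by the reindexing have
lower index above the upper one and vanish. -/
theorem Nat.sum_antidiagonal_choose_two_mul_add (N : ℕ) :
    ∑ p ∈ antidiagonal N, (2 * p.1 + p.2).choose p.2 = Nat.fib (2 * N + 1) ∧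
      ∑ p ∈ antidiagonal N, (2 * p.1 + 1 + p.2).choose p.2 = Nat.fib (2 * N + 2) := by
  have aux : ∀ e M, e ≤ 1 → ∑ p ∈ antidiagonal M, (2 * p.1 + e + p.2).choose p.2 =
      ∑ p ∈ antidiagonal (2 * M + e), p.1.choose p.2 := by
    intro e M he
    refine sum_of_injOn (fun p ↦ (2 * p.1 + e + p.2, p.2)) ?_ ?_ ?_ ?_
    · rintro ⟨a, b⟩ - ⟨c, d⟩ - h
      simp only [Prod.mk.injEq] at h ⊢
      omega
    · rintro ⟨a, b⟩ h
      simp only [mem_coe, HasAntidiagonal.mem_antidiagonal] at h ⊢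
      omega
    · rintro ⟨a, b⟩ h h'
      simp only [HasAntidiagonal.mem_antidiagonal] at h
      refine Nat.choose_eq_zero_of_lt ?_
      by_contra hlt
      refine h' ⟨(M - b, b), ?_, ?_⟩
      · simp only [mem_coe, HasAntidiagonal.mem_antidiagonal]
        omega
      · exact Prod.ext (show 2 * (M - b) + e + b = a by omega) rfl
    · simp
  have h0 := aux 0 N (by omega)
  have h1 := aux 1 N le_rfl
  simp only [add_zero] at h0
  rw [h0, h1, ← Nat.fib_succ_eq_sum_choose, ← Nat.fib_succ_eq_sum_choose]
  exact ⟨rfl, rfl⟩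

theorem Nat.sum_antidiagonal_two_pow_mul_fib (N : ℕ) :
    ∑ q ∈ antidiagonal N, 2 ^ q.1 * Nat.fib (2 * q.2 + 2) + 2 ^ (N + 2) = Nat.fib (2 * N + 5) := by
  induction N with
  | zero => simp [Nat.fib_add_two]
  | succ N ih =>
    rw [Finset.Nat.sum_antidiagonal_succ]
    have : ∑ p ∈ antidiagonal N, 2 ^ (p.1 + 1) * Nat.fib (2 * p.2 + 2) =
        2 * ∑ p ∈ antidiagonal N, 2 ^ p.1 * Nat.fib (2 * p.2 + 2) := by
      rw [mul_sum]
      exact sum_congr rfl fun p _ ↦ by ring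
    rw [this, show 2 * (N + 1) + 5 = 2 * N + 5 + 2 by ring, Nat.fib_add_two (n := 2 * N + 5)]
    have h6 := Nat.fib_add_two (n := 2 * N + 4)
    have h5 := Nat.fib_add_two (n := 2 * N + 3)
    rw [show 2 * (N + 1) + 2 = 2 * N + 4 by ring, pow_zero, one_mul, pow_succ 2 (N + 2),
      h6, show 2 * N + 4 + 1 = 2 * N + 5 by ring] at *
    simp only [pow_succ] at *
    omega

/-- This is the expansion of (2 + 1)^t, except that for `p.1 = 0` the truncated exponent turns the
term 1 into 2. -/
theorem Nat.two_mul_sum_antidiagonal_choose_mul_two_pow_pred (t : ℕ) :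
    2 * ∑ p ∈ antidiagonal t, (p.1 + p.2).choose p.2 * 2 ^ (p.1 - 1) = 3 ^ t + 1 := by
  have h := (Commute.all (2 : ℕ) 1).add_pow' t
  rw [show (2 + 1 : ℕ) = 3 by rfl] at h
  rw [h, mul_sum, Finset.Nat.sum_antidiagonal_eq_sum_range_succ_mk,
    Finset.Nat.sum_antidiagonal_eq_sum_range_succ_mk, sum_range_succ', sum_range_succ', add_assoc]
  congr 1
  · refine sum_congr rfl fun i hi ↦ ?_
    rw [mem_range] at hi
    simp only [one_pow, mul_one, Nat.add_sub_cancel, smul_eq_mul]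
    rw [show i + 1 + (t - (i + 1)) = t by omega, Nat.choose_symm (by omega), pow_succ]
    ring
  · simp

theorem Nat.sum_range_fib_odd (N : ℕ) :
    ∑ i ∈ range (N + 1), Nat.fib (2 * i + 1) = Nat.fib (2 * N + 2) := by
  induction N with
  | zero => rfl
  | succ N ih =>
    rw [sum_range_succ, ih, show 2 * (N + 1) + 2 = 2 * N + 2 + 2 by ring,
      Nat.fib_add_two (n := 2 * N + 2)]
    rfl

theorem Nat.sum_antidiagonal_three_pow_mul_fib (N : ℕ) :
    ∑ q ∈ antidiagonal N, (3 ^ q.1 + 1) * Nat.fib (2 * q.2 + 1) + 2 * Nat.fib (2 * N + 3) =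
      2 * 3 ^ (N + 1) := by
  have h1 : ∀ M, ∑ q ∈ antidiagonal M, Nat.fib (2 * q.2 + 1) = Nat.fib (2 * M + 2) := by
    intro M
    rw [← Nat.sum_range_fib_odd, ← Finset.sum_range_reflect,
      Finset.Nat.sum_antidiagonal_eq_sum_range_succ_mk]
    refine sum_congr rfl fun i hi ↦ ?_
    simp
  have h2 : ∀ M, ∑ q ∈ antidiagonal M, 3 ^ q.1 * Nat.fib (2 * q.2 + 1) + Nat.fib (2 * M + 5) =
      2 * 3 ^ (M + 1) := by
    intro M
    induction M with
    | zero => simp [Nat.fib_add_two]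
    | succ M ih =>
      rw [Finset.Nat.sum_antidiagonal_succ]
      have : ∑ p ∈ antidiagonal M, 3 ^ (p.1 + 1) * Nat.fib (2 * p.2 + 1) =
          3 * ∑ p ∈ antidiagonal M, 3 ^ p.1 * Nat.fib (2 * p.2 + 1) := by
        rw [mul_sum]
        exact sum_congr rfl fun p _ ↦ by ring
      have h7 : Nat.fib (2 * M + 7) = Nat.fib (2 * M + 5) + Nat.fib (2 * M + 6) := Nat.fib_add_two
      have h6 : Nat.fib (2 * M + 6) = Nat.fib (2 * M + 4) + Nat.fib (2 * M + 5) := Nat.fib_add_two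
      have h5 : Nat.fib (2 * M + 5) = Nat.fib (2 * M + 3) + Nat.fib (2 * M + 4) := Nat.fib_add_two
      rw [this, pow_succ 3 (M + 1), ← mul_assoc, ← ih, show 2 * (M + 1) + 1 = 2 * M + 3 by ring,
        show 2 * (M + 1) + 5 = 2 * M + 7 by ring]
      simp only [pow_zero, one_mul]
      omega
  have := h2 N
  have h5 : Nat.fib (2 * N + 5) = Nat.fib (2 * N + 3) + Nat.fib (2 * N + 4) := Nat.fib_add_two
  have h4 : Nat.fib (2 * N + 4) = Nat.fib (2 * N + 2) + Nat.fib (2 * N + 3) := Nat.fib_add_two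
  simp only [add_mul, one_mul, sum_add_distrib, h1]
  omega

theorem Nat.sum_antidiagonal_choose_mul_two_pow (t : ℕ) :
    2 * ∑ r ∈ antidiagonal t, (r.1 + 1 + r.2).choose r.2 * 2 ^ r.1 + 1 = 3 ^ (t + 1) := by
  have h := (Commute.all (2 : ℕ) 1).add_pow' (t + 1)
  rw [show (2 + 1 : ℕ) = 3 by rfl] at h
  rw [h, Finset.Nat.sum_antidiagonal_succ, mul_sum, add_comm]
  congr 1
  · simp
  refine sum_congr rfl fun r hr ↦ ?_
  rw [HasAntidiagonal.mem_antidiagonal] at hr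
  simp only [one_pow, mul_one, smul_eq_mul]
  rw [show r.1 + 1 + r.2 = t + 1 by omega, ← Nat.choose_symm_of_eq_add (a := r.1 + 1) (b := r.2)
    (by omega), pow_succ]
  ring

theorem Nat.sum_antidiagonal_sum_choose_mul_two_pow (N : ℕ) :
    2 * ∑ q ∈ antidiagonal N, ∑ r ∈ antidiagonal q.2,
      (r.1 + 1 + r.2).choose r.2 * 2 ^ (q.1 + r.1) + 2 ^ (N + 3) = 3 ^ (N + 2) + 1 := by
  induction N with
  | zero => simp
  | succ N ih =>
    rw [Finset.Nat.sum_antidiagonal_succ]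
    have : ∑ p ∈ antidiagonal N, ∑ r ∈ antidiagonal p.2,
        (r.1 + 1 + r.2).choose r.2 * 2 ^ (p.1 + 1 + r.1) =
        2 * ∑ p ∈ antidiagonal N, ∑ r ∈ antidiagonal p.2,
          (r.1 + 1 + r.2).choose r.2 * 2 ^ (p.1 + r.1) := by
      simp only [mul_sum]
      exact sum_congr rfl fun p _ ↦ sum_congr rfl fun r _ ↦ by ring
    rw [this]
    have h := Nat.sum_antidiagonal_choose_mul_two_pow (N + 1)
    simp only [zero_add, pow_succ] at *
    omega

end Sums

/-! ### The two totals -/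

namespace rootFilters

open Finset

variable {n : ℕ} {D : Set (ℕ × ℕ)}

theorem sum_tripleIndex {M : Type*} [AddCommMonoid M] (N : ℕ) (f : ℕ → ℕ → ℕ → M) :
    ∑ p ∈ tripleIndex N, f p.1.1 p.2.1 p.2.2 =
      ∑ q ∈ antidiagonal N, ∑ r ∈ antidiagonal q.2, f q.1 r.1 r.2 := by
  rw [tripleIndex, sum_sigma]

/-- Applied with crossing column `2 * n + 1 - a` (row `a` empty) and with the middle column `n + 1`,
where `n = N + 2`. By `hinj` the column depends only on `a = k + s + 2`, so a filter determines its
parameters. -/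
theorem ncard_colStart_param {N : ℕ} (y : ℕ → ℕ → ℕ)
    (hy : ∀ s m k, k + s + m = N → k + s + 2 ≤ y s m ∧ N + 2 ≤ y s m ∧ k + y s m ≤ 2 * (N + 2))
    (hinj : ∀ s m k s' m' k', k + s + m = N → k' + s' + m' = N → k + s = k' + s' →
      y s m = y s' m') :
    {D ∈ rootFilters (N + 2) 1 2 | ∃ p ∈ tripleIndex N, RowGap D 1 (p.2.2 + p.1.1 + 2) ∧
      (1, p.2.2 + p.1.1 + 2) ∈ D ∧ (2 < p.2.2 + 2 → (p.2.2 + 2 - 1, y p.1.1 p.2.1) ∈ D) ∧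
        RowGap D (p.2.2 + 2) (y p.1.1 p.2.1 + 1)}.ncard =
      ∑ q ∈ antidiagonal N, ∑ r ∈ antidiagonal q.2,
        (y q.1 r.1 - (r.2 + q.1 + 2) + r.2).choose r.2 *
          2 ^ (2 * (N + 2) + 2 - (r.2 + 2) - (y q.1 r.1 + 1)) := by
  rw [Set.ncard_sep_exists_eq_sum (finite _ _ _)]
  · rw [← sum_tripleIndex N fun s m k ↦ (y s m - (k + s + 2) + k).choose k *
      2 ^ (2 * (N + 2) + 2 - (k + 2) - (y s m + 1))]
    refine sum_congr rfl ?_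
    rintro ⟨⟨s, t⟩, ⟨m, k⟩⟩ hp
    rw [mem_tripleIndex] at hp
    have := hy s m k (by omega)
    exact ncard_colStart_of_rowStart (s := s) (m := m) (k := k) (y := y s m)
      (by omega) (by omega) (by omega) (by omega)
  · rintro D hD ⟨⟨s, t⟩, ⟨m, k⟩⟩ hp ⟨⟨s', t'⟩, ⟨m', k'⟩⟩ hp' ⟨h1, h2, h3, h4⟩ ⟨h1', h2', h3', h4'⟩
    rw [mem_tripleIndex] at hp hp'
    dsimp only at h1 h2 h3 h4 h1' h2' h3' h4'
    have e1 := rowStart_unique h1 h2 h1' h2'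
    have e2 := hinj s m k s' m' k' (by omega) (by omega) (by omega)
    rw [← e2] at h3' h4'
    have e3 := colStart_unique (i₀ := 2) hD (by omega) (by omega) (by omega) h3 h4 h3' h4'
    obtain rfl : k = k' := by omega
    obtain rfl : s = s' := by omega
    obtain rfl : m = m' := by omega
    obtain rfl : t = t' := by omega
    rfl

/-- Classifying by the row in which the boundary crosses column `y a` turns a gap in row `a` into an
indexed family of conditions. -/
theorem exists_colStart_param {N : ℕ} (hD : D ∈ rootFilters (N + 2) 1 2) (y : ℕ → ℕ)
    (hy : ∀ a, 2 ≤ a → a ≤ N + 2 → a + y a ≤ 2 * (N + 2) + 2) :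
    (∃ a, 2 ≤ a ∧ a ≤ N + 2 ∧ RowGap D 1 a ∧ (1, a) ∈ D ∧ RowGap D a (y a + 1)) ↔
      ∃ p ∈ tripleIndex N, RowGap D 1 (p.2.2 + p.1.1 + 2) ∧
      (1, p.2.2 + p.1.1 + 2) ∈ D ∧
        (2 < p.2.2 + 2 → (p.2.2 + 2 - 1, y (p.2.2 + p.1.1 + 2)) ∈ D) ∧
        RowGap D (p.2.2 + 2) (y (p.2.2 + p.1.1 + 2) + 1) := by
  constructor
  · rintro ⟨a, h1, h2, h3, h4, h5⟩
    obtain ⟨r, h6, h7, h8, h9⟩ := exists_colStart (i₀ := 2) hD (by omega) h1 h5 (hy a h1 h2)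
    obtain ⟨k, rfl⟩ := Nat.exists_eq_add_of_le' h6
    obtain ⟨s, rfl⟩ := Nat.exists_eq_add_of_le h7
    refine ⟨⟨(s, N - s), (N - s - k, k)⟩, mem_tripleIndex.2 (by omega), ?_⟩
    rw [show k + 2 + s = k + s + 2 by ring] at *
    exact ⟨h3, h4, h8, h9⟩
  · rintro ⟨⟨⟨s, t⟩, ⟨m, k⟩⟩, hp, h1, h2, h3, h4⟩
    rw [mem_tripleIndex] at hp
    dsimp only at h1 h2 h3 h4
    refine ⟨k + s + 2, by omega, by omega, h1, h2, fun j hj hjD ↦ ?_⟩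
    have hb := hD.1 _ _ hjD
    exact h4 j hj (mem_of_le hD hjD (by omega) (by omega) le_rfl (by omega))

/-- Filters with `f(1) = a ≤ n` and empty row `a`, where `f(i)` is the first column of row `i`. -/
theorem ncard_row_empty (N : ℕ) :
    {D ∈ rootFilters (N + 2) 1 2 | ∃ a, 2 ≤ a ∧ a ≤ N + 2 ∧ RowGap D 1 a ∧ (1, a) ∈ D ∧
      RowGap D a (2 * (N + 2) + 2 - a)}.ncard =
      ∑ q ∈ antidiagonal N, 2 ^ q.1 * Nat.fib (2 * q.2 + 2) := by
  have h := ncard_colStart_param (N := N) (fun s m ↦ N + m + 3) (by intros; omega) (by intros; omega)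
  have h' : ∀ D ∈ rootFilters (N + 2) 1 2, _ := fun D hD ↦ exists_colStart_param (N := N) (D := D) hD
    (fun a ↦ 2 * N + 5 - a) (by intros; omega)
  refine Eq.trans ?_ (h.trans ?_)
  · congr 1
    ext D
    simp only [Set.mem_ofPred_eq]
    refine and_congr_right fun hD ↦ ?_
    refine Iff.trans ?_ ((h' D hD).trans ?_)
    · refine exists_congr fun a ↦ and_congr_right fun h1 ↦ and_congr_right fun h2 ↦ ?_
      rw [show 2 * (N + 2) + 2 - a = 2 * N + 5 - a + 1 by omega]
    · refine exists_congr ?_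
      rintro ⟨⟨s, t⟩, ⟨m, k⟩⟩
      refine and_congr_right fun hp ↦ ?_
      rw [mem_tripleIndex] at hp
      dsimp only
      rw [show 2 * N + 5 - (k + s + 2) = N + m + 3 by omega]
  · refine sum_congr rfl fun q hq ↦ ?_
    rw [← (Nat.sum_antidiagonal_choose_two_mul_add q.2).2, mul_sum]
    refine sum_congr rfl fun r hr ↦ ?_
    rw [HasAntidiagonal.mem_antidiagonal] at hq hr
    rw [mul_comm (2 ^ q.1)]
    congr 2 <;> omega

theorem ncard_row_nonempty (N : ℕ) :
    {D ∈ rootFilters (N + 3) 1 2 | ∃ a c, 2 ≤ a ∧ a < c ∧ c ≤ N + 3 ∧ RowGap D 1 a ∧ (1, a) ∈ D ∧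
      RowGap D a (2 * (N + 3) + 2 - c) ∧ (a, 2 * (N + 3) + 2 - c) ∈ D ∧ RowGap D 2 (c + 1)}.ncard =
      ∑ q ∈ antidiagonal N, 2 ^ q.1 * Nat.fib (2 * q.2 + 2) := by
  have h : ∀ D, (∃ a c, 2 ≤ a ∧ a < c ∧ c ≤ N + 3 ∧ RowGap D 1 a ∧ (1, a) ∈ D ∧
      RowGap D a (2 * (N + 3) + 2 - c) ∧ (a, 2 * (N + 3) + 2 - c) ∈ D ∧ RowGap D 2 (c + 1)) ↔
      ∃ p ∈ tripleIndex N, RowGap D 1 (p.2.2 + 2) ∧ (1, p.2.2 + 2) ∈ D ∧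
      RowGap D (p.2.2 + 2) (p.2.2 + p.1.1 + 2 * p.2.1 + 5) ∧
      (p.2.2 + 2, p.2.2 + p.1.1 + 2 * p.2.1 + 5) ∈ D ∧ RowGap D 2 (p.2.2 + p.1.1 + 4) := by
    intro D
    constructor
    · rintro ⟨a, c, h1, h2, h3, h4⟩
      obtain ⟨k, rfl⟩ := Nat.exists_eq_add_of_le' h1
      obtain ⟨d, rfl⟩ := Nat.exists_eq_add_of_le (Nat.succ_le_of_lt h2)
      refine ⟨⟨(d, N - d), (N - d - k, k)⟩, mem_tripleIndex.2 (by omega), ?_⟩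
      dsimp only
      rw [show k + d + 2 * (N - d - k) + 5 = 2 * (N + 3) + 2 - ((k + 2).succ + d) by omega,
        show k + d + 4 = (k + 2).succ + d + 1 by omega]
      exact h4
    · rintro ⟨⟨⟨d, t⟩, ⟨m, k⟩⟩, hp, h⟩
      rw [mem_tripleIndex] at hp
      dsimp only at h
      refine ⟨k + 2, k + d + 3, by omega, by omega, by omega, ?_⟩
      rw [show 2 * (N + 3) + 2 - (k + d + 3) = k + d + 2 * m + 5 by omega]
      exact h
  simp only [h]
  rw [Set.ncard_sep_exists_eq_sum (finite _ _ _)]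
  · rw [sum_congr rfl (g := fun p ↦ (2 * p.2.1 + 1 + p.2.2).choose p.2.2 * 2 ^ p.1.1),
      sum_tripleIndex N fun s m k ↦ (2 * m + 1 + k).choose k * 2 ^ s]
    · refine sum_congr rfl fun q hq ↦ ?_
      rw [← (Nat.sum_antidiagonal_choose_two_mul_add q.2).2, mul_sum]
      exact sum_congr rfl fun r hr ↦ mul_comm _ _
    · rintro ⟨⟨d, t⟩, ⟨m, k⟩⟩ hp
      rw [mem_tripleIndex] at hp
      exact ncard_secondRow_start (m := m) (d := d) (k := k) (by omega)
  · rintro D hD ⟨⟨s, t⟩, ⟨m, k⟩⟩ hp ⟨⟨s', t'⟩, ⟨m', k'⟩⟩ hp' ⟨h1, h2, h3, h4, -⟩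
      ⟨h1', h2', h3', h4', -⟩
    rw [mem_tripleIndex] at hp hp'
    dsimp only at h1 h2 h3 h4 h1' h2' h3' h4'
    have e1 := rowStart_unique h1 h2 h1' h2'
    obtain rfl : k = k' := by omega
    have e2 := rowStart_unique h3 h4 h3' h4'
    obtain rfl : s = s' := by omega
    obtain rfl : m = m' := by omega
    obtain rfl : t = t' := by omega
    rfl

/-- The alternatives contribute `2 ^ n`, `Nat.fib (2 * n + 1) - 2 ^ n` and `Nat.fib (2 * n - 1) - 2
^ (n - 1)`. -/
theorem ncard_not_exists_three_chain (hn : 1 ≤ n) :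
    {D ∈ rootFilters n 1 2 | ¬ ∃ a b, FoldMem n D 1 a ∧ FoldMem n D a b ∧
      FoldMem n D b (2 * n)}.ncard + 2 ^ (n - 1) = Nat.fib (2 * n + 1) + Nat.fib (2 * n - 1) := by
  have h : {D ∈ rootFilters n 1 2 | ¬ ∃ a b, FoldMem n D 1 a ∧ FoldMem n D a b ∧
      FoldMem n D b (2 * n)} = {D ∈ rootFilters n 1 2 | RowGap D 1 (n + 1) ∨
      (∃ a, 2 ≤ a ∧ a ≤ n ∧ RowGap D 1 a ∧ (1, a) ∈ D ∧ RowGap D a (2 * n + 2 - a)) ∨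
      (∃ a c, 2 ≤ a ∧ a < c ∧ c ≤ n ∧ RowGap D 1 a ∧ (1, a) ∈ D ∧ RowGap D a (2 * n + 2 - c) ∧
        (a, 2 * n + 2 - c) ∈ D ∧ RowGap D 2 (c + 1))} := by
    ext D
    exact and_congr_right fun hD ↦ not_exists_three_chain_iff hD
  rw [h, Set.ncard_sep_or (finite _ _ _), Set.ncard_sep_or (finite _ _ _), ncard_firstRow_gap hn]
  · obtain rfl | rfl | ⟨N, rfl⟩ : n = 1 ∨ n = 2 ∨ ∃ N, n = N + 3 := by
      rcases n with _ | _ | _ | N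
      · omega
      · simp
      · simp
      · simp
    · have e1 : {D ∈ rootFilters 1 1 2 | ∃ a, 2 ≤ a ∧ a ≤ 1 ∧ RowGap D 1 a ∧ (1, a) ∈ D ∧
          RowGap D a (2 * 1 + 2 - a)} = ∅ := by
        ext D
        simp only [Set.mem_ofPred_eq, Set.mem_empty_iff_false, iff_false, not_and, not_exists]
        intros; omega
      have e2 : {D ∈ rootFilters 1 1 2 | ∃ a c, 2 ≤ a ∧ a < c ∧ c ≤ 1 ∧ RowGap D 1 a ∧ (1, a) ∈ D ∧
          RowGap D a (2 * 1 + 2 - c) ∧ (a, 2 * 1 + 2 - c) ∈ D ∧ RowGap D 2 (c + 1)} = ∅ := by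
        ext D
        simp only [Set.mem_ofPred_eq, Set.mem_empty_iff_false, iff_false, not_and, not_exists]
        intros; omega
      rw [e1, e2]
      simp [Nat.fib_add_two]
    · have e2 : {D ∈ rootFilters 2 1 2 | ∃ a c, 2 ≤ a ∧ a < c ∧ c ≤ 2 ∧ RowGap D 1 a ∧ (1, a) ∈ D ∧
          RowGap D a (2 * 2 + 2 - c) ∧ (a, 2 * 2 + 2 - c) ∈ D ∧ RowGap D 2 (c + 1)} = ∅ := by
        ext D
        simp only [Set.mem_ofPred_eq, Set.mem_empty_iff_false, iff_false, not_and, not_exists]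
        intros; omega
      have e1 := ncard_row_empty 0
      simp only [zero_add] at e1
      rw [e1, e2]
      simp [Nat.fib_add_two]
    · rw [ncard_row_nonempty N, show N + 3 = (N + 1) + 2 by rfl, ncard_row_empty (N + 1)]
      have h1 := Nat.sum_antidiagonal_two_pow_mul_fib N
      have h2 := Nat.sum_antidiagonal_two_pow_mul_fib (N + 1)
      rw [show 2 * (N + 1) + 5 = 2 * N + 7 by ring] at h2
      rw [show 2 * (N + 1 + 2) + 1 = 2 * N + 7 by ring,
        show 2 * (N + 1 + 2) - 1 = 2 * N + 5 by omega, show N + 1 + 2 - 1 = N + 2 by omega]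
      omega
  · rintro D hD ⟨a, h1, h2, h3, h4, h5⟩ ⟨a', c, h1', h2', h3', h4', h5', h6', h7', -⟩
    obtain rfl := rowStart_unique h3 h4 h4' h5'
    have := h5.le h7'
    omega
  · rintro D hD h1 (⟨a, -, h2, -, h3, -⟩ | ⟨a, c, -, h2, h2', -, h3, -⟩) <;> have := h1.le h3 <;>
      omega

/-- Only the first column `a` of row 1 needs testing: a lower row reaching column `n + 1` forces row
`a` to do so. -/
theorem ncard_not_exists_first_mem (hn : 1 ≤ n) :
    2 * {D ∈ rootFilters n 1 2 | ¬ ∃ a ≤ n, (1, a) ∈ D ∧ (a, n + 1) ∈ D}.ncard = 3 ^ n + 1 := by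
  have h : {D ∈ rootFilters n 1 2 | ¬ ∃ a ≤ n, (1, a) ∈ D ∧ (a, n + 1) ∈ D} =
      {D ∈ rootFilters n 1 2 | RowGap D 1 (n + 1) ∨
        ∃ a, 2 ≤ a ∧ a ≤ n ∧ RowGap D 1 a ∧ (1, a) ∈ D ∧ RowGap D a (n + 1 + 1)} := by
    ext D
    refine and_congr_right fun hD ↦ ?_
    constructor
    · intro hno
      refine or_iff_not_imp_left.2 fun h1 ↦ ?_
      obtain ⟨a, h2, h3, h4⟩ := exists_rowStart h1
      have := hD.1 _ _ h4
      refine ⟨a, by omega, by omega, h3, h4, fun j hj hjD ↦ hno ⟨a, by omega, h4, ?_⟩⟩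
      exact mem_of_le hD hjD (by omega) le_rfl (by omega) (by omega)
    · rintro (h | ⟨a, h1, h2, h3, h4, h5⟩) ⟨a', h1', h2', h3'⟩
      · have := h.le h2'
        omega
      · have := h3.le h2'
        have := h5.le (mem_of_le hD h3' (by omega) this le_rfl (by omega))
        omega
  rw [h, Set.ncard_sep_or (finite _ _ _), ncard_firstRow_gap hn]
  · rcases n with _ | _ | N
    · omega
    · have e1 : {D ∈ rootFilters (0 + 1) 1 2 | ∃ a, 2 ≤ a ∧ a ≤ 0 + 1 ∧ RowGap D 1 a ∧ (1, a) ∈ D ∧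
          RowGap D a (0 + 1 + 1 + 1)} = ∅ := by
        ext D
        simp only [Set.mem_ofPred_eq, Set.mem_empty_iff_false, iff_false, not_and, not_exists]
        intros; omega
      rw [e1]
      simp
    · have h := ncard_colStart_param (N := N) (fun s m ↦ N + 3) (by intros; omega)
        (by intros; omega)
      have e : ∀ q ∈ antidiagonal N, ∑ r ∈ antidiagonal q.2,
          (N + 3 - (r.2 + q.1 + 2) + r.2).choose r.2 *
            2 ^ (2 * (N + 2) + 2 - (r.2 + 2) - (N + 3 + 1)) =
          ∑ r ∈ antidiagonal q.2, (r.1 + 1 + r.2).choose r.2 * 2 ^ (q.1 + r.1) := by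
        intro q hq
        refine sum_congr rfl fun r hr ↦ ?_
        rw [HasAntidiagonal.mem_antidiagonal] at hq hr
        congr 2 <;> omega
      have h' : {D ∈ rootFilters (N + 2) 1 2 | ∃ a, 2 ≤ a ∧ a ≤ N + 2 ∧ RowGap D 1 a ∧
          (1, a) ∈ D ∧ RowGap D a (N + 2 + 1 + 1)}.ncard = ∑ q ∈ antidiagonal N,
            ∑ r ∈ antidiagonal q.2, (r.1 + 1 + r.2).choose r.2 * 2 ^ (q.1 + r.1) := by
        refine (congrArg Set.ncard ?_).trans (h.trans (sum_congr rfl e))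
        ext D
        exact and_congr_right fun hD ↦ exists_colStart_param (N := N) (D := D) hD
          (fun a ↦ N + 3) (by intros; omega)
      rw [show N + 1 + 1 = N + 2 by rfl, h']
      have := Nat.sum_antidiagonal_sum_choose_mul_two_pow N
      rw [mul_add, ← this, pow_succ 2 (N + 2)]
      ring
  · rintro D hD h1 ⟨a, -, h2, -, h3, -⟩
    have := h1.le h3
    omega

/-- Grouping the parameters as `(s, k)` and `(m, l)` makes the count a product of a power-of-three
sum and a Fibonacci sum. -/
theorem ncard_exists_short_type (N : ℕ) :
    2 * {D ∈ rootFilters (N + 2) 1 2 | ∃ a b r, 2 ≤ a ∧ a < r ∧ r ≤ b ∧ b ≤ N + 2 + 1 ∧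
      RowGap D 1 a ∧ (1, a) ∈ D ∧ RowGap D 2 r ∧ RowGap D a b ∧ (a, b) ∈ D ∧
      (a + 1 < r → (r - 1, 2 * (N + 2) + 2 - b) ∈ D) ∧
        RowGap D r (2 * (N + 2) + 2 - b + 1)}.ncard =
      ∑ q ∈ antidiagonal N, (3 ^ q.1 + 1) * Nat.fib (2 * q.2 + 1) := by
  have h : ∀ D, (∃ a b r, 2 ≤ a ∧ a < r ∧ r ≤ b ∧ b ≤ N + 2 + 1 ∧
      RowGap D 1 a ∧ (1, a) ∈ D ∧ RowGap D 2 r ∧ RowGap D a b ∧ (a, b) ∈ D ∧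
      (a + 1 < r → (r - 1, 2 * (N + 2) + 2 - b) ∈ D) ∧
        RowGap D r (2 * (N + 2) + 2 - b + 1)) ↔
      ∃ p ∈ (antidiagonal N).sigma fun q ↦ antidiagonal q.1 ×ˢ antidiagonal q.2,
        RowGap D 1 (p.2.1.2 + 2) ∧ (1, p.2.1.2 + 2) ∈ D ∧ RowGap D 2 (p.2.1.2 + p.2.2.2 + 3) ∧
        RowGap D (p.2.1.2 + 2) (p.2.1.2 + p.2.2.2 + p.2.1.1 + 3) ∧
        (p.2.1.2 + 2, p.2.1.2 + p.2.2.2 + p.2.1.1 + 3) ∈ D ∧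
        (p.2.1.2 + 2 + 1 < p.2.1.2 + p.2.2.2 + 3 →
          (p.2.1.2 + p.2.2.2 + 3 - 1, p.2.1.2 + p.2.2.2 + p.2.1.1 + 2 * p.2.2.1 + 3) ∈ D) ∧
        RowGap D (p.2.1.2 + p.2.2.2 + 3)
          (p.2.1.2 + p.2.2.2 + p.2.1.1 + 2 * p.2.2.1 + 3 + 1) := by
    intro D
    constructor
    · rintro ⟨a, b, r, h1, h2, h3, h4, h5⟩
      obtain ⟨k, rfl⟩ := Nat.exists_eq_add_of_le' h1
      obtain ⟨l, rfl⟩ := Nat.exists_eq_add_of_le (Nat.succ_le_of_lt h2)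
      obtain ⟨s, rfl⟩ := Nat.exists_eq_add_of_le h3
      refine ⟨⟨(s + k, N - s - k), ((s, k), (N - s - k - l, l))⟩, ?_, ?_⟩
      · simp only [mem_sigma, mem_product, HasAntidiagonal.mem_antidiagonal]
        constructor
        · omega
        · exact ⟨trivial, by omega⟩
      dsimp only
      rw [show k + l + s + 2 * (N - s - k - l) + 3 = 2 * (N + 2) + 2 - ((k + 2).succ + l + s) by omega,
        show k + l + s + 3 = (k + 2).succ + l + s by omega, show k + l + 3 = (k + 2).succ + l by omega]
      exact h5
    · rintro ⟨⟨⟨t, p⟩, ⟨⟨s, k⟩, ⟨m, l⟩⟩⟩, hp, h⟩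
      simp only [mem_sigma, mem_product, HasAntidiagonal.mem_antidiagonal] at hp
      dsimp only at h
      refine ⟨k + 2, k + l + s + 3, k + l + 3, by omega, by omega, by omega, by omega, ?_⟩
      rw [show 2 * (N + 2) + 2 - (k + l + s + 3) = k + l + s + 2 * m + 3 by omega]
      exact h
  simp only [h]
  rw [Set.ncard_sep_exists_eq_sum (finite _ _ _)]
  · rw [sum_congr rfl (g := fun p ↦ (p.2.1.1 + p.2.1.2).choose p.2.1.2 *
      ((2 * p.2.2.1 + p.2.2.2).choose p.2.2.2 * 2 ^ (p.2.1.1 - 1))), sum_sigma, mul_sum]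
    · refine sum_congr rfl fun q hq ↦ ?_
      rw [← (Nat.sum_antidiagonal_choose_two_mul_add q.2).1,
        ← Nat.two_mul_sum_antidiagonal_choose_mul_two_pow_pred, mul_assoc, sum_mul_sum, sum_product]
      congr 1
      exact sum_congr rfl fun r hr ↦ sum_congr rfl fun r' hr' ↦ by ring
    · rintro ⟨⟨t, p⟩, ⟨⟨s, k⟩, ⟨m, l⟩⟩⟩ hp
      simp only [mem_sigma, mem_product, HasAntidiagonal.mem_antidiagonal] at hp
      exact ncard_short_type (k := k) (l := l) (s := s) (m := m) (by omega)
  · rintro D hD ⟨⟨t, p⟩, ⟨⟨s, k⟩, ⟨m, l⟩⟩⟩ hp ⟨⟨t', p'⟩, ⟨⟨s', k'⟩, ⟨m', l'⟩⟩⟩ hp'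
      ⟨h1, h2, h3, h4, h5, h6, h7⟩ ⟨h1', h2', h3', h4', h5', h6', h7'⟩
    simp only [mem_sigma, mem_product, HasAntidiagonal.mem_antidiagonal] at hp hp'
    dsimp only at h1 h2 h3 h4 h5 h6 h7 h1' h2' h3' h4' h5' h6' h7'
    have e1 := rowStart_unique h1 h2 h1' h2'
    obtain rfl : k = k' := by omega
    have e2 := rowStart_unique h4 h5 h4' h5'
    rw [show k + l' + s' + 2 * m' + 3 = k + l + s + 2 * m + 3 by omega] at h6' h7'
    have e3 := colStart_unique (i₀ := k + 2 + 1) hD (by omega) (by omega) (by omega) h6 h7 h6' h7'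
    obtain rfl : l = l' := by omega
    obtain rfl : s = s' := by omega
    obtain rfl : m = m' := by omega
    obtain rfl : t = t' := by omega
    obtain rfl : p = p' := by omega
    rfl

theorem ncard_not_exists_four_chain (hn : 1 ≤ n) :
    2 * {D ∈ rootFilters n 1 2 | ¬ ∃ a b c, FoldMem n D 1 a ∧ FoldMem n D a b ∧
      FoldMem n D b c ∧ FoldMem n D c (2 * n)}.ncard + 2 * Nat.fib (2 * n - 1) =
      5 * 3 ^ (n - 1) + 1 := by
  have h : {D ∈ rootFilters n 1 2 | ¬ ∃ a b c, FoldMem n D 1 a ∧ FoldMem n D a b ∧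
      FoldMem n D b c ∧ FoldMem n D c (2 * n)} =
      {D ∈ rootFilters n 1 2 | (¬ ∃ a ≤ n, (1, a) ∈ D ∧ (a, n + 1) ∈ D) ∨
      (∃ a b r, 2 ≤ a ∧ a < r ∧ r ≤ b ∧ b ≤ n + 1 ∧ RowGap D 1 a ∧ (1, a) ∈ D ∧ RowGap D 2 r ∧
        RowGap D a b ∧ (a, b) ∈ D ∧ (a + 1 < r → (r - 1, 2 * n + 2 - b) ∈ D) ∧
        RowGap D r (2 * n + 2 - b + 1))} := by
    ext D
    exact and_congr_right fun hD ↦ not_exists_four_chain_iff hD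
  rw [h, Set.ncard_sep_or (finite _ _ _), mul_add, ncard_not_exists_first_mem hn]
  · rcases n with _ | _ | N
    · omega
    · have e1 : {D ∈ rootFilters (0 + 1) 1 2 | ∃ a b r, 2 ≤ a ∧ a < r ∧ r ≤ b ∧ b ≤ 0 + 1 + 1 ∧
          RowGap D 1 a ∧ (1, a) ∈ D ∧ RowGap D 2 r ∧
          RowGap D a b ∧ (a, b) ∈ D ∧ (a + 1 < r → (r - 1, 2 * (0 + 1) + 2 - b) ∈ D) ∧
          RowGap D r (2 * (0 + 1) + 2 - b + 1)} = ∅ := by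
        ext D
        simp only [Set.mem_ofPred_eq, Set.mem_empty_iff_false, iff_false, not_and, not_exists]
        intros; omega
      rw [e1]
      simp
    · rw [show N + 1 + 1 = N + 2 by rfl, ncard_exists_short_type N]
      have h1 := Nat.sum_antidiagonal_three_pow_mul_fib N
      rw [show 2 * (N + 2) - 1 = 2 * N + 3 by omega, show N + 2 - 1 = N + 1 by omega]
      rw [show 3 ^ (N + 2) = 3 * 3 ^ (N + 1) by ring]
      omega
  · rintro D hD h1 ⟨a, b, r, h2, h3, h4, h5, -, h6, -, -, h7, -⟩
    have := hD.1 _ _ h7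
    exact h1 ⟨a, by omega, h6, mem_of_le hD h7 (by omega) le_rfl h5 (by omega)⟩

end rootFilters

/-! ### Brackets of root vectors -/

open LieModule Module

section Bracket

variable {K L : Type*} [Field K] [CharZero K] [LieRing L] [LieAlgebra K L] [FiniteDimensional K L]
  [IsKilling K L] {H : LieSubalgebra K L} [H.IsCartanSubalgebra] [IsTriangularizable K H L]

theorem LieAlgebra.IsKilling.exists_smul_eq_of_mem_rootSpace {α : Weight K H L} (hα : α.IsNonZero)
    {x y : L} (hx : x ∈ rootSpace H α) (hx0 : x ≠ 0) (hy : y ∈ rootSpace H α) :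
    ∃ c : K, c • x = y := by
  obtain ⟨c, hc⟩ := (finrank_eq_one_iff_of_nonzero' (⟨x, hx⟩ : rootSpace H α) (by simpa using hx0)).mp
    (finrank_rootSpace_eq_one α hα) ⟨y, hy⟩
  exact ⟨c, by simpa using congrArg Subtype.val hc⟩

/-- Root spaces are lines, so up to scalars `x` is the `e` of an sl₂-triple for `α`, and `y` is `f ^
(q + 1) v` with `v` at the top of the `α`-string through `β`. The string goes on above `β` because
`α + β` is a weight, and `e f ^ (q + 1) v` is a nonzero multiple of `f ^ q v`. -/
theorem LieAlgebra.IsKilling.lie_ne_zero_of_mem_rootSpace {α β : Weight K H L} (hα : α.IsNonZero)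
    (hβ : β.IsNonZero) (hαβ : rootSpace H (⇑α + ⇑β) ≠ ⊥) {x y : L} (hx : x ∈ rootSpace H α)
    (hx0 : x ≠ 0) (hy : y ∈ rootSpace H β) (hy0 : y ≠ 0) : ⁅x, y⁆ ≠ 0 := by
  obtain ⟨v, hv, v_ne0⟩ := (chainTop α β).exists_ne_zero
  obtain ⟨h, e, f, isSl2, he, hf⟩ := exists_isSl2Triple_of_weight_isNonZero hα
  obtain rfl := isSl2.h_eq_coroot hα he hf
  have prim : isSl2.HasPrimitiveVectorWith v (chainLength α β : K) :=
    have := lie_mem_genWeightSpace_of_mem_genWeightSpace he hv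
    ⟨v_ne0, (chainLength_smul _ _ hv).symm, by rwa [genWeightSpace_add_chainTop _ _ hα] at this⟩
  have hq : 1 ≤ chainTopCoeff α β := by
    have := ((rootSpace_zsmul_add_ne_bot_iff α β hα 1).mp (by simpa using hαβ)).1
    exact_mod_cast this
  obtain ⟨q, hq'⟩ := Nat.exists_eq_add_of_le' hq
  have hlen := chainTopCoeff_le_chainLength α β
  have hmem : ((toEnd K L L f) ^ (q + 1)) v ∈ rootSpace H β := by
    have := toEnd_pow_apply_mem hf hv (q + 1)
    convert! this using 2
    rw [coe_chainTop', hq', smul_neg, neg_add_cancel_left]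
  have hne := prim.pow_toEnd_f_ne_zero_of_eq_nat rfl (i := q + 1) (by omega)
  obtain ⟨c, rfl⟩ := exists_smul_eq_of_mem_rootSpace hα he isSl2.e_ne_zero hx
  obtain ⟨d, rfl⟩ := exists_smul_eq_of_mem_rootSpace hβ hmem hne hy
  have hc : c ≠ 0 := by rintro rfl; simp at hx0
  have hd : d ≠ 0 := by rintro rfl; simp at hy0
  rw [smul_lie, lie_smul, prim.lie_e_pow_succ_toEnd_f]
  refine smul_ne_zero hc (smul_ne_zero hd (smul_ne_zero (mul_ne_zero ?_ ?_)
    (prim.pow_toEnd_f_ne_zero_of_eq_nat rfl (by omega))))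
  · exact_mod_cast Nat.succ_ne_zero q
  · rw [sub_ne_zero]
    exact_mod_cast (show chainLength α β ≠ q by omega)

end Bracket

/-! ### From ad-nilpotent ideals to filters of positive roots -/

section Ideals

set_option linter.unusedSectionVars false

variable {L : Type*} [LieRing L] [LieAlgebra ℂ L] [FiniteDimensional ℂ L] [LieAlgebra.IsSimple ℂ L]
  {H : LieSubalgebra ℂ L} [H.IsCartanSubalgebra]

/-- The sum of the root spaces of the roots in `Φ`. -/
noncomputable def sumRootSpaces (Φ : Set H.root) : Submodule ℂ L :=
  ⨆ α ∈ Φ, (rootSpace H α.1).toSubmodule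

/-- The roots that are a sum of a root in `Φ` and a root in `Ψ`. -/
def rootAdd (Φ Ψ : Set H.root) : Set H.root :=
  {γ | ∃ α ∈ Φ, ∃ β ∈ Ψ, (rootSystem H).root γ = (rootSystem H).root α + (rootSystem H).root β}

theorem rootSpace_le_sumRootSpaces {Φ : Set H.root} {α : H.root} (hα : α ∈ Φ) :
    (rootSpace H α.1).toSubmodule ≤ sumRootSpaces Φ :=
  le_iSup₂_of_le α hα le_rfl

theorem coe_root_eq_add {α β γ : H.root}
    (h : (rootSystem H).root γ = (rootSystem H).root α + (rootSystem H).root β) :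
    (γ.1 : H → ℂ) = ⇑α.1 + ⇑β.1 := by
  ext x
  simpa using congrArg (fun f : Dual ℂ H ↦ f x) h

theorem mem_of_rootSpace_le {Φ : Set H.root} {α : H.root}
    (h : (rootSpace H α.1).toSubmodule ≤ H.toSubmodule ⊔ sumRootSpaces Φ) : α ∈ Φ := by
  by_contra hα
  have hle : H.toSubmodule ⊔ sumRootSpaces Φ ≤
      (⨆ (χ : H → ℂ) (_ : χ ≠ (α.1 : H → ℂ)), genWeightSpace L χ).toSubmodule := by
    refine sup_le ?_ (iSup₂_le fun β hβ ↦ ?_)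
    · have : (genWeightSpace L (0 : H → ℂ)) ≤
          ⨆ (χ : H → ℂ) (_ : χ ≠ (α.1 : H → ℂ)), genWeightSpace L χ :=
        le_iSup₂_of_le 0 (fun h ↦ H.isNonZero_coe_root α h.symm) le_rfl
      refine le_trans ?_ this
      rw [show genWeightSpace L (0 : H → ℂ) = H.toLieSubmodule from rootSpace_zero_eq ℂ L H]
      exact le_rfl
    · have : (genWeightSpace L (β.1 : H → ℂ)) ≤
          ⨆ (χ : H → ℂ) (_ : χ ≠ (α.1 : H → ℂ)), genWeightSpace L χ :=
        le_iSup₂_of_le _ (fun h ↦ hα (by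
          have : β.1 = α.1 := DFunLike.coe_injective h
          rwa [← Subtype.ext this])) le_rfl
      exact this
  have h_disj := (iSupIndep_genWeightSpace ℂ H L) (α.1 : H → ℂ)
  have h_le : genWeightSpace L (α.1 : H → ℂ) ≤
      ⨆ (χ : H → ℂ) (_ : χ ≠ (α.1 : H → ℂ)), genWeightSpace L χ := fun x hx ↦ hle (h hx)
  exact α.1.genWeightSpace_ne_bot L (disjoint_self.mp (h_disj.mono_right h_le))

theorem sumRootSpaces_injective : Function.Injective (sumRootSpaces (H := H)) := by
  intro Φ Ψ h
  ext α
  constructor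
  · intro hα
    exact mem_of_rootSpace_le ((rootSpace_le_sumRootSpaces hα).trans (h ▸ le_sup_right))
  · intro hα
    exact mem_of_rootSpace_le ((rootSpace_le_sumRootSpaces hα).trans (h ▸ le_sup_right))

theorem lie_mem_rootSpace_of_isPos {b : (rootSystem H).Base} {α β : H.root} (hα : b.IsPos α)
    (hβ : b.IsPos β) {x y : L} (hx : x ∈ rootSpace H α.1) (hy : y ∈ rootSpace H β.1) :
    ⁅x, y⁆ = 0 ∨ ∃ γ : H.root, (rootSystem H).root γ =
      (rootSystem H).root α + (rootSystem H).root β ∧ ⁅x, y⁆ ∈ rootSpace H γ.1 := by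
  have hxy : ⁅x, y⁆ ∈ rootSpace H (⇑α.1 + ⇑β.1) :=
    lie_mem_genWeightSpace_of_mem_genWeightSpace hx hy
  by_cases hbot : rootSpace H (⇑α.1 + ⇑β.1) = ⊥
  · rw [hbot, LieSubmodule.mem_bot] at hxy
    exact Or.inl hxy
  right
  let γ : LieModule.Weight ℂ H L := ⟨⇑α.1 + ⇑β.1, hbot⟩
  have hγ : γ.IsNonZero := by
    intro h0
    have h1 : (rootSystem H).root α = -(rootSystem H).root β := by
      ext x
      have := congrFun h0 x
      simpa [γ, eq_neg_iff_add_eq_zero] using this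
    let := (rootSystem H).indexNeg
    have h2 : α = -β := by
      apply (rootSystem H).root.injective
      rw [h1, RootPairing.indexNeg_neg, RootPairing.root_reflectionPerm,
        RootPairing.reflection_apply_self]
    rw [RootPairing.Base.isPos_iff] at hα hβ
    rw [h2, b.height_reflectionPerm_self] at hα
    omega
  exact ⟨⟨γ, by simpa using hγ⟩, by ext x; simp [γ], hxy⟩

theorem lie_mem_sumRootSpaces {b : (rootSystem H).Base} {Φ Ψ : Set H.root}
    (hΦ : ∀ α ∈ Φ, b.IsPos α) (hΨ : ∀ α ∈ Ψ, b.IsPos α) {x y : L} (hx : x ∈ sumRootSpaces Φ)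
    (hy : y ∈ sumRootSpaces Ψ) : ⁅x, y⁆ ∈ sumRootSpaces (rootAdd Φ Ψ) := by
  let f : L →ₗ[ℂ] L →ₗ[ℂ] L := (LieAlgebra.ad ℂ L : L →ₗ[ℂ] Module.End ℂ L)
  suffices h : Submodule.map₂ f (sumRootSpaces Φ) (sumRootSpaces Ψ) ≤
      sumRootSpaces (rootAdd Φ Ψ) from h (Submodule.apply_mem_map₂ f hx hy)
  simp only [sumRootSpaces, Submodule.map₂_iSup_left, Submodule.map₂_iSup_right]
  refine iSup₂_le fun β hβ ↦ iSup₂_le fun α hα ↦ Submodule.map₂_le.mpr fun x hx y hy ↦ ?_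
  change ⁅x, y⁆ ∈ sumRootSpaces (rootAdd Φ Ψ)
  rcases lie_mem_rootSpace_of_isPos (hΦ α hα) (hΨ β hβ) hx hy with h | ⟨γ, hγ, h⟩
  · rw [h]
    exact zero_mem _
  · exact rootSpace_le_sumRootSpaces (Φ := rootAdd Φ Ψ) ⟨α, hα, β, hβ, hγ⟩ h

/-- `[𝔤_α, 𝔤_β] = 𝔤_{α + β}`. -/
theorem rootSpace_le_of_forall_lie_mem {α β γ : H.root}
    (hγ : (rootSystem H).root γ = (rootSystem H).root α + (rootSystem H).root β)
    (N : Submodule ℂ L) (hN : ∀ x ∈ rootSpace H α.1, ∀ y ∈ rootSpace H β.1, ⁅x, y⁆ ∈ N) :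
    (rootSpace H γ.1).toSubmodule ≤ N := by
  have hγ' := coe_root_eq_add hγ
  obtain ⟨x, hx, hx0⟩ := α.1.exists_ne_zero
  obtain ⟨y, hy, hy0⟩ := β.1.exists_ne_zero
  have hne := lie_ne_zero_of_mem_rootSpace (H.isNonZero_coe_root α) (H.isNonZero_coe_root β)
    (hγ' ▸ γ.1.genWeightSpace_ne_bot) hx hx0 hy hy0
  have hmem : ⁅x, y⁆ ∈ rootSpace H γ.1 := by
    rw [hγ']
    exact lie_mem_genWeightSpace_of_mem_genWeightSpace hx hy
  intro z hz
  obtain ⟨c, rfl⟩ := exists_smul_eq_of_mem_rootSpace (H.isNonZero_coe_root γ) hmem hne hz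
  exact N.smul_mem c (hN x hx y hy)

variable {b : (rootSystem H).Base}

theorem borelSubalgebra_toSubmodule :
    (borelSubalgebra b).toSubmodule = H.toSubmodule ⊔ sumRootSpaces {α | b.IsPos α} := by
  rw [sumRootSpaces, iSup_subtype']
  rfl

theorem le_borelSubalgebra : H.toSubmodule ≤ (borelSubalgebra b).toSubmodule := by
  rw [borelSubalgebra_toSubmodule]
  exact le_sup_left

theorem sumRootSpaces_le_borelSubalgebra {Φ : Set H.root} (hΦ : ∀ α ∈ Φ, b.IsPos α) :
    sumRootSpaces Φ ≤ (borelSubalgebra b).toSubmodule := by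
  rw [borelSubalgebra_toSubmodule]
  exact (iSup₂_le fun α hα ↦ rootSpace_le_sumRootSpaces (hΦ α hα)).trans le_sup_right

/-- The elements of an ideal of the Borel subalgebra as a subspace of the whole Lie algebra. -/
noncomputable def idealSubmodule (I : LieIdeal ℂ (borelSubalgebra b)) : Submodule ℂ L :=
  I.toSubmodule.map (borelSubalgebra b).toSubmodule.subtype

theorem mem_idealSubmodule {I : LieIdeal ℂ (borelSubalgebra b)} {x : L} :
    x ∈ idealSubmodule I ↔ ∃ h : x ∈ borelSubalgebra b, (⟨x, h⟩ : borelSubalgebra b) ∈ I := by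
  constructor
  · rintro ⟨y, hy, rfl⟩
    exact ⟨y.2, hy⟩
  · rintro ⟨h, hx⟩
    exact ⟨⟨x, h⟩, hx, rfl⟩

theorem idealSubmodule_injective :
    Function.Injective (idealSubmodule (b := b)) := by
  intro I J h
  ext ⟨x, hx⟩
  have := Submodule.ext_iff.1 h x
  simpa [mem_idealSubmodule, hx] using this

theorem lie_mem_idealSubmodule {I : LieIdeal ℂ (borelSubalgebra b)} {x y : L}
    (hx : x ∈ borelSubalgebra b) (hy : y ∈ idealSubmodule I) : ⁅x, y⁆ ∈ idealSubmodule I := by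
  obtain ⟨hy, hyI⟩ := mem_idealSubmodule.1 hy
  exact mem_idealSubmodule.2 ⟨LieSubalgebra.lie_mem _ hx hy,
    lie_mem_right ℂ _ I ⟨x, hx⟩ ⟨y, hy⟩ hyI⟩

/-- The roots whose root spaces lie in an ideal of the Borel subalgebra. -/
def idealRoots (I : LieIdeal ℂ (borelSubalgebra b)) : Set H.root :=
  {α | (rootSpace H α.1).toSubmodule ≤ idealSubmodule I}

/-- An `H`-stable subspace is the sum of its intersections with the weight spaces; a one-dimensional
root space is contained in it or meets it in zero. -/
theorem idealSubmodule_eq_sumRootSpaces {I : LieIdeal ℂ (borelSubalgebra b)}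
    (hI : IsAdNilpotentIdeal I) : idealSubmodule I = sumRootSpaces (idealRoots I) := by
  refine le_antisymm ?_ (iSup₂_le fun α hα ↦ hα)
  let N : LieSubmodule ℂ H L :=
    { __ := idealSubmodule I
      lie_mem := fun {x m} hm ↦ lie_mem_idealSubmodule (le_borelSubalgebra x.2) hm }
  have hN : idealSubmodule I = ⨆ χ : Weight ℂ H L, (N ⊓ genWeightSpace L χ).toSubmodule := by
    rw [← LieSubmodule.iSup_toSubmodule, ← eq_iSup_inf_genWeightSpace (N := N)]
  rw [hN]
  refine iSup_le fun χ ↦ ?_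
  by_cases hχ : χ.IsZero
  · rintro x ⟨hxI, hx⟩
    have hx' : x ∈ rootSpace H (0 : H → ℂ) := by rwa [hχ] at hx
    rw [rootSpace_zero_eq] at hx'
    obtain ⟨hxb, hxI⟩ := mem_idealSubmodule.1 hxI
    -- Elements of `H` are ad-semisimple, so ad-nilpotency removes the zero weight part.
    rw [eq_zero_of_isNilpotent_ad_of_mem_isCartanSubalgebra ℂ L H hx' (hI _ hxI)]
    exact zero_mem _
  · by_cases h : (rootSpace H χ).toSubmodule ≤ idealSubmodule I
    · exact le_trans inf_le_right
        (rootSpace_le_sumRootSpaces (Φ := idealRoots I) (α := ⟨χ, by simpa using hχ⟩) h)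
    · have ha := Submodule.isAtom_iff_finrank_eq_one.mpr (finrank_rootSpace_eq_one χ hχ)
      have : N.toSubmodule ⊓ (rootSpace H χ).toSubmodule = ⊥ :=
        (ha.not_le_iff_disjoint.mp h).symm.eq_bot
      rw [LieSubmodule.inf_toSubmodule, this]
      exact bot_le

/-- The sets of positive roots that are closed under adding positive roots. -/
def IsPosFilter (b : (rootSystem H).Base) (Φ : Set H.root) : Prop :=
  (∀ α ∈ Φ, b.IsPos α) ∧ rootAdd {α | b.IsPos α} Φ ⊆ Φ

theorem isPosFilter_idealRoots (I : LieIdeal ℂ (borelSubalgebra b)) :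
    IsPosFilter b (idealRoots I) := by
  refine ⟨fun α hα ↦ ?_, ?_⟩
  · refine mem_of_rootSpace_le (Φ := {α | b.IsPos α}) ?_
    rw [← borelSubalgebra_toSubmodule]
    refine hα.trans fun x hx ↦ ?_
    exact (mem_idealSubmodule.1 hx).1
  · rintro γ ⟨α, hα, β, hβ, hγ⟩
    refine rootSpace_le_of_forall_lie_mem hγ _ fun x hx y hy ↦ lie_mem_idealSubmodule ?_ (hβ hy)
    exact sumRootSpaces_le_borelSubalgebra (fun _ h ↦ h) (rootSpace_le_sumRootSpaces hα hx)

end Ideals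

/-! ### From filters of positive roots to ad-nilpotent ideals -/

section AdNilpotent

variable {L : Type*} [LieRing L] [LieAlgebra ℂ L] [FiniteDimensional ℂ L] [LieAlgebra.IsSimple ℂ L]
  {H : LieSubalgebra ℂ L} [H.IsCartanSubalgebra]

theorem exists_linearMap_root_eq_height (b : (rootSystem H).Base) :
    ∃ φ : Dual ℂ H →ₗ[ℂ] ℂ, ∀ α, φ ((rootSystem H).root α) = b.height α := by
  refine ⟨b.toWeightBasis.constr ℂ fun _ ↦ (1 : ℂ), fun α ↦ ?_⟩
  have h1 (i : b.support) : b.toWeightBasis.constr ℂ (fun _ ↦ (1 : ℂ)) ((rootSystem H).root i) = 1 := by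
    rw [← b.toWeightBasis_apply, Basis.constr_basis]
  obtain ⟨f, -, -, hf⟩ := b.exists_root_eq_sum_int α
  rw [b.height_eq_sum hf, hf, map_sum]
  push_cast
  refine Finset.sum_congr rfl fun i hi ↦ ?_
  rw [map_zsmul, h1 ⟨i, hi⟩]
  simp

/-- The sum of the weight spaces on which the grading `φ` takes an integral value at least `m`. -/
noncomputable def weightFiltration (φ : Dual ℂ H →ₗ[ℂ] ℂ) (m : ℤ) : Submodule ℂ L :=
  ⨆ (χ : Weight ℂ H L) (_ : ∃ k : ℤ, m ≤ k ∧ φ χ.toLinear = k), (genWeightSpace L χ).toSubmodule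

theorem lie_mem_weightFiltration {b : (rootSystem H).Base} {φ : Dual ℂ H →ₗ[ℂ] ℂ}
    (hφ : ∀ α, φ ((rootSystem H).root α) = b.height α) {m : ℤ} {x y : L}
    (hx : x ∈ sumRootSpaces {α | b.IsPos α}) (hy : y ∈ weightFiltration φ m) :
    ⁅x, y⁆ ∈ weightFiltration φ (m + 1) := by
  let f : L →ₗ[ℂ] L →ₗ[ℂ] L := (LieAlgebra.ad ℂ L : L →ₗ[ℂ] Module.End ℂ L)
  suffices h : Submodule.map₂ f (sumRootSpaces {α | b.IsPos α}) (weightFiltration φ m) ≤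
      weightFiltration φ (m + 1) from h (Submodule.apply_mem_map₂ f hx hy)
  conv_lhs => simp only [sumRootSpaces, weightFiltration, Submodule.map₂_iSup_left,
    Submodule.map₂_iSup_right]
  refine iSup₂_le fun χ ⟨k, hk, hχ⟩ ↦ iSup₂_le fun α hα ↦
    Submodule.map₂_le.mpr fun x hx y hy ↦ ?_
  change ⁅x, y⁆ ∈ weightFiltration φ (m + 1)
  have hxy : ⁅x, y⁆ ∈ genWeightSpace L (⇑α.1 + ⇑χ) :=
    lie_mem_genWeightSpace_of_mem_genWeightSpace hx hy
  by_cases hbot : genWeightSpace L (⇑α.1 + ⇑χ) = ⊥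
  · rw [hbot, LieSubmodule.mem_bot] at hxy
    rw [hxy]
    exact zero_mem _
  let ψ : Weight ℂ H L := ⟨⇑α.1 + ⇑χ, hbot⟩
  have hα' : 0 < b.height α := hα
  have hψ : ψ.toLinear = (rootSystem H).root α + χ.toLinear := by
    ext x
    simp [ψ]
  have hle : (genWeightSpace L ψ).toSubmodule ≤ weightFiltration φ (m + 1) :=
    le_iSup₂_of_le (f := fun (χ : Weight ℂ H L) (_ : ∃ k : ℤ, m + 1 ≤ k ∧ φ χ.toLinear = k) ↦
      (genWeightSpace L χ).toSubmodule) ψ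
      ⟨b.height α + k, by omega, by rw [hψ, map_add, hφ, hχ]; push_cast; rfl⟩ le_rfl
  exact hle hxy

/-- Bracketing with `x` raises the height by at least one, and heights lie in `[-N, N]`; hence the
exponent `2 * N + 1`. -/
theorem isNilpotent_ad_of_mem_sumRootSpaces {b : (rootSystem H).Base} {x : L}
    (hx : x ∈ sumRootSpaces {α | b.IsPos α}) : _root_.IsNilpotent (LieAlgebra.ad ℂ L x) := by
  obtain ⟨φ, hφ⟩ := exists_linearMap_root_eq_height b
  obtain ⟨N, hN⟩ := Finite.exists_le fun α ↦ (b.height α).natAbs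
  have hint (χ : Weight ℂ H L) : ∃ k : ℤ, φ χ.toLinear = k ∧ k.natAbs ≤ N := by
    by_cases hχ : χ.IsZero
    · refine ⟨0, ?_, by simp⟩
      have : χ.toLinear = 0 := by
        ext x
        exact congrFun hχ x
      simp [this]
    · exact ⟨_, hφ ⟨χ, by simpa using hχ⟩, hN _⟩
  have htop : weightFiltration φ (-N : ℤ) = (⊤ : Submodule ℂ L) := by
    rw [eq_top_iff, ← LieSubmodule.top_toSubmodule (R := ℂ) (L := H) (M := L),
      ← iSup_genWeightSpace_eq_top' ℂ H L, LieSubmodule.iSup_toSubmodule]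
    refine iSup_le fun χ ↦ ?_
    obtain ⟨k, hk, hkN⟩ := hint χ
    exact le_iSup₂_of_le (f := fun (χ : Weight ℂ H L) (_ : ∃ k : ℤ, (-N : ℤ) ≤ k ∧ φ χ.toLinear = k)
      ↦ (genWeightSpace L χ).toSubmodule) χ ⟨k, by omega, hk⟩ le_rfl
  have hbot : weightFiltration φ (N + 1 : ℤ) = (⊥ : Submodule ℂ L) := by
    refine eq_bot_iff.2 (iSup₂_le fun χ ⟨k, hk, hχ⟩ ↦ ?_)
    obtain ⟨l, hl, hlN⟩ := hint χ
    have : k = l := by exact_mod_cast hχ.symm.trans hl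
    omega
  refine ⟨2 * N + 1, ?_⟩
  ext y
  have key (k : ℕ) : ((LieAlgebra.ad ℂ L x) ^ k) y ∈ weightFiltration φ (-N + k : ℤ) := by
    induction k with
    | zero => simp [htop]
    | succ k ih =>
      rw [pow_succ', Module.End.mul_apply, Nat.cast_succ, ← add_assoc]
      exact lie_mem_weightFiltration hφ hx ih
  have := key (2 * N + 1)
  rw [show (-N + (2 * N + 1 : ℕ) : ℤ) = N + 1 by push_cast; ring, hbot] at this
  simpa using this

theorem sumRootSpaces_mono {Φ Ψ : Set H.root} (h : Φ ⊆ Ψ) : sumRootSpaces Φ ≤ sumRootSpaces Ψ :=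
  iSup₂_le fun _ hα ↦ rootSpace_le_sumRootSpaces (h hα)

theorem exists_ideal_of_isPosFilter {b : (rootSystem H).Base} {Φ : Set H.root}
    (hΦ : IsPosFilter b Φ) : ∃ I : LieIdeal ℂ (borelSubalgebra b),
      IsAdNilpotentIdeal I ∧ idealRoots I = Φ := by
  have hmem {x y : L} (hx : x ∈ borelSubalgebra b) (hy : y ∈ sumRootSpaces Φ) :
      ⁅x, y⁆ ∈ sumRootSpaces Φ := by
    have hx : x ∈ (borelSubalgebra b).toSubmodule := hx
    rw [borelSubalgebra_toSubmodule] at hx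
    obtain ⟨h, hh, z, hz, rfl⟩ := Submodule.mem_sup.1 hx
    rw [add_lie]
    refine add_mem ?_ (sumRootSpaces_mono hΦ.2 (lie_mem_sumRootSpaces (fun _ h ↦ h) hΦ.1 hz hy))
    have hsum : sumRootSpaces Φ = (⨆ α ∈ Φ, rootSpace H α.1).toSubmodule := by
      simp [sumRootSpaces, LieSubmodule.iSup_toSubmodule]
    rw [hsum] at hy ⊢
    exact (⨆ α ∈ Φ, rootSpace H α.1).lie_mem (x := (⟨h, hh⟩ : H)) hy
  let I : LieIdeal ℂ (borelSubalgebra b) :=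
    { __ := (sumRootSpaces Φ).comap (borelSubalgebra b).toSubmodule.subtype
      lie_mem := fun {x m} hm ↦ hmem x.2 hm }
  have hI : IsAdNilpotentIdeal I := fun x hx ↦
    isNilpotent_ad_of_mem_sumRootSpaces (b := b) (sumRootSpaces_mono hΦ.1 hx)
  refine ⟨I, hI, sumRootSpaces_injective ?_⟩
  rw [← idealSubmodule_eq_sumRootSpaces hI]
  ext x
  rw [mem_idealSubmodule]
  exact ⟨fun ⟨_, h⟩ ↦ h, fun h ↦ ⟨sumRootSpaces_le_borelSubalgebra hΦ.1 h, h⟩⟩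

theorem idealRoots_injOn (b : (rootSystem H).Base) :
    Set.InjOn (idealRoots (b := b)) {I | IsAdNilpotentIdeal I} := by
  intro I hI J hJ h
  refine idealSubmodule_injective ?_
  rw [idealSubmodule_eq_sumRootSpaces hI, idealSubmodule_eq_sumRootSpaces hJ, h]

end AdNilpotent

/-! ### The lower central series in terms of roots -/

section NilpotenceClass

variable {L : Type*} [LieRing L] [LieAlgebra ℂ L] [FiniteDimensional ℂ L] [LieAlgebra.IsSimple ℂ L]
  {H : LieSubalgebra ℂ L} [H.IsCartanSubalgebra]

/-- The roots that are a sum of `k + 1` roots of `Φ`, all partial sums of which, taken from the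
right, are roots. -/
def rootPow (Φ : Set H.root) : ℕ → Set H.root
  | 0 => Φ
  | k + 1 => rootAdd Φ (rootPow Φ k)

variable {b : (rootSystem H).Base}

theorem rootPow_subset {Φ : Set H.root} (hΦ : IsPosFilter b Φ) (k : ℕ) : rootPow Φ k ⊆ Φ := by
  induction k with
  | zero => exact subset_rfl
  | succ k ih =>
    rintro γ ⟨α, hα, β, hβ, h⟩
    exact hΦ.2 ⟨α, hΦ.1 α hα, β, ih hβ, h⟩

theorem map_lowerCentralSeries_eq {I : LieIdeal ℂ (borelSubalgebra b)} (hI : IsAdNilpotentIdeal I)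
    (k : ℕ) : (lowerCentralSeries ℂ I I k).toSubmodule.map
      ((borelSubalgebra b).toSubmodule.subtype ∘ₗ I.toSubmodule.subtype) =
      sumRootSpaces (rootPow (idealRoots I) k) := by
  have hΦ := isPosFilter_idealRoots I
  have hpos (k : ℕ) : ∀ α ∈ rootPow (idealRoots I) k, b.IsPos α := fun α hα ↦
    hΦ.1 α (rootPow_subset hΦ k hα)
  induction k with
  | zero =>
    rw [lowerCentralSeries_zero, LieSubmodule.top_toSubmodule, Submodule.map_comp,
      Submodule.map_subtype_top]
    exact idealSubmodule_eq_sumRootSpaces hI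
  | succ k ih =>
    rw [lowerCentralSeries_succ, LieSubmodule.lieIdeal_oper_eq_linear_span', Submodule.map_span]
    refine le_antisymm (Submodule.span_le.2 ?_) (iSup₂_le fun γ hγ ↦ ?_)
    · rintro _ ⟨_, ⟨x, -, y, hy, rfl⟩, rfl⟩
      refine lie_mem_sumRootSpaces (x := ((x : borelSubalgebra b) : L))
        (y := ((y : borelSubalgebra b) : L)) (hpos 0) (hpos k) ?_ ?_
      · rw [rootPow, ← idealSubmodule_eq_sumRootSpaces hI]
        exact mem_idealSubmodule.2 ⟨x.1.2, x.2⟩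
      · rw [← ih]
        exact ⟨y, hy, rfl⟩
    · obtain ⟨α, hα, β, hβ, h⟩ := hγ
      refine rootSpace_le_of_forall_lie_mem h _ fun x hx y hy ↦ Submodule.subset_span ?_
      obtain ⟨hxb, hxI⟩ := mem_idealSubmodule.1 (hα hx)
      have hy' := rootSpace_le_sumRootSpaces hβ hy
      rw [← ih] at hy'
      obtain ⟨z, hz, rfl⟩ := hy'
      exact ⟨⁅(⟨⟨x, hxb⟩, hxI⟩ : I), z⁆, ⟨_, LieSubmodule.mem_top _, z, hz, rfl⟩, rfl⟩

theorem nilpotenceClass_le_iff {I : LieIdeal ℂ (borelSubalgebra b)} (hI : IsAdNilpotentIdeal I)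
    (k : ℕ) : nilpotenceClass I ≤ k ↔ rootPow (idealRoots I) k = ∅ := by
  have h1 : rootPow (idealRoots I) k = ∅ ↔ lowerCentralSeries ℂ I I k = ⊥ := by
    have hinj : Function.Injective
        ((borelSubalgebra b).toSubmodule.subtype ∘ₗ I.toSubmodule.subtype) :=
      (Submodule.subtype_injective _).comp (Submodule.subtype_injective _)
    rw [← LieSubmodule.toSubmodule_eq_bot, ← (Submodule.map_injective_of_injective hinj).eq_iff,
      map_lowerCentralSeries_eq hI, Submodule.map_bot]
    refine ⟨fun h ↦ by simp [h, sumRootSpaces], fun h ↦ sumRootSpaces_injective ?_⟩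
    rw [h]
    simp [sumRootSpaces]
  have := hI.isNilpotent
  -- `nilpotencyLength` refers to the lower central series over ℤ, which has the same underlying
  -- sets as the one over ℂ.
  have h2 (k : ℕ) : lowerCentralSeries ℂ I I k = ⊥ ↔ lowerCentralSeries ℤ I I k = ⊥ := by
    simp [SetLike.ext'_iff, coe_lowerCentralSeries_eq_int ℂ I I]
  rw [h1, h2]
  have hne : {k | lowerCentralSeries ℤ I I k = ⊥}.Nonempty :=
    LieModule.IsNilpotent.nilpotent ℤ I I
  refine ⟨fun h ↦ ?_, fun h ↦ Nat.sInf_le h⟩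
  exact eq_bot_iff.2 ((antitone_lowerCentralSeries ℤ I I h).trans_eq (Nat.sInf_mem hne))

theorem ncard_adNilpotent_eq_ncard_isPosFilter (b : (rootSystem H).Base) (k : ℕ) :
    {I : LieIdeal ℂ (borelSubalgebra b) | IsAdNilpotentIdeal I ∧ nilpotenceClass I ≤ k}.ncard =
      {Φ | IsPosFilter b Φ ∧ rootPow Φ k = ∅}.ncard := by
  refine Set.ncard_congr (fun I _ ↦ idealRoots I) ?_ ?_ ?_
  · rintro I ⟨hI, h⟩
    exact ⟨isPosFilter_idealRoots I, (nilpotenceClass_le_iff hI k).1 h⟩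
  · rintro I J ⟨hI, -⟩ ⟨hJ, -⟩ h
    exact idealRoots_injOn b hI hJ h
  · rintro Φ ⟨hΦ, h⟩
    obtain ⟨I, hI, rfl⟩ := exists_ideal_of_isPosFilter hΦ
    exact ⟨I, ⟨hI, (nilpotenceClass_le_iff hI k).2 h⟩, rfl⟩

end NilpotenceClass

/-! ### The root system of type B_n in coordinates -/

namespace RootPairing.Base

set_option linter.unusedSectionVars false

open Module

variable {ι K M N : Type*} [Finite ι] [Field K] [CharZero K] [AddCommGroup M] [Module K M]
  [AddCommGroup N] [Module K N] {P : RootPairing ι K M N} [P.IsRootSystem] [P.IsCrystallographic]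
  [P.IsReduced] {b : P.Base} {n : ℕ}

/-- The simple root with number `k`, where `1 ≤ k ≤ n`. -/
def numberedRoot (e : Fin n ≃ b.support) (k : ℕ) : M :=
  if h : k - 1 < n then P.root (e ⟨k - 1, h⟩) else 0

/-- The vectors `ε_k` with `ε_k - ε_{k+1} = α_k` for `1 ≤ k ≤ n`, `ε_{n+1} = 0` and
`ε_{2n+2-k} = -ε_k`. -/
def stdVector (e : Fin n ≃ b.support) (k : ℕ) : M :=
  if k ≤ n + 1 then ∑ m ∈ Finset.Icc k n, numberedRoot e m
  else -∑ m ∈ Finset.Icc (2 * n + 2 - k) n, numberedRoot e m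

variable {e : Fin n ≃ b.support}

theorem stdVector_mid : stdVector e (n + 1) = 0 := by
  simp [stdVector]

theorem stdVector_mirror {k : ℕ} (hk : k ≤ 2 * n + 2) :
    stdVector e (2 * n + 2 - k) = -stdVector e k := by
  rcases lt_trichotomy k (n + 1) with h | rfl | h
  · rw [stdVector, stdVector, if_neg (by omega), if_pos (by omega), Nat.sub_sub_self hk]
  · rw [show 2 * n + 2 - (n + 1) = n + 1 by omega, stdVector_mid, neg_zero]
  · rw [stdVector, stdVector, if_pos (by omega), if_neg (by omega), neg_neg]

theorem stdVector_eq_add {k : ℕ} (hk : k ≤ n) :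
    stdVector e k = numberedRoot e k + stdVector e (k + 1) := by
  rw [stdVector, stdVector, if_pos (by omega), if_pos (by omega)]
  have : Finset.Icc k n = insert k (Finset.Icc (k + 1) n) := by
    ext
    simp
    omega
  rw [this, Finset.sum_insert (by simp)]

/-- Odd functions of the indices of the vectors `ε_k` extend to linear functionals. -/
theorem exists_linearMap_stdVector (e : Fin n ≃ b.support) (g : ℕ → ℤ)
    (hg : ∀ k, 1 ≤ k → k ≤ 2 * n + 1 → g (2 * n + 2 - k) = -g k) :
    ∃ ψ : M →ₗ[K] K, ∀ k, 1 ≤ k → k ≤ 2 * n + 1 → ψ (stdVector e k) = g k := by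
  let ψ : M →ₗ[K] K := b.toWeightBasis.constr K
    fun i ↦ ((g ((e.symm i).1 + 1) - g ((e.symm i).1 + 2) : ℤ) : K)
  have hψ {k : ℕ} (h1 : 1 ≤ k) (hk : k ≤ n) : ψ (numberedRoot e k) = (g k - g (k + 1) : ℤ) := by
    rw [numberedRoot, dif_pos (by omega), ← b.toWeightBasis_apply, Basis.constr_basis]
    simp only [Equiv.symm_apply_apply]
    rw [show k - 1 + 1 = k by omega, show k - 1 + 2 = k + 1 by omega]
  have hmid : g (n + 1) = 0 := by
    have := hg (n + 1) (by omega) (by omega)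
    rw [show 2 * n + 2 - (n + 1) = n + 1 by omega] at this
    omega
  have hle {k : ℕ} (h1 : 1 ≤ k) (hk : k ≤ n + 1) : ψ (stdVector e k) = g k := by
    induction hd : n + 1 - k generalizing k with
    | zero =>
      obtain rfl : k = n + 1 := by omega
      rw [stdVector_mid, hmid]
      simp
    | succ d ih =>
      rw [stdVector_eq_add (by omega), map_add, hψ h1 (by omega), ih (by omega) (by omega) (by omega)]
      push_cast
      ring
  refine ⟨ψ, fun k h1 hk ↦ ?_⟩
  rcases le_or_gt k (n + 1) with h | h
  · exact hle h1 h
  · have := hle (k := 2 * n + 2 - k) (by omega) (by omega)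
    rw [stdVector_mirror (by omega), map_neg, hg k h1 hk] at this
    push_cast at this
    exact neg_inj.1 this

theorem height_eq_of_root_eq_sub {γ : ι} {i j : ℕ} (hi : 1 ≤ i) (hi' : i ≤ 2 * n + 1) (hj : 1 ≤ j)
    (hj' : j ≤ 2 * n + 1) (h : P.root γ = stdVector e i - stdVector e j) :
    b.height γ = j - i := by
  -- This functional takes the value 1 on every simple root, hence agrees with the height.
  obtain ⟨ψ, hψ⟩ := exists_linearMap_stdVector e (fun k ↦ (n + 1 - k : ℤ)) (fun k h1 hk ↦ by omega)
  have hsimple (i : b.support) : ψ (P.root i) = 1 := by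
    obtain ⟨k, rfl⟩ := e.surjective i
    have : P.root (e k) = stdVector e (k + 1) - stdVector e (k + 2) := by
      rw [stdVector_eq_add (by omega), numberedRoot, dif_pos (by omega)]
      simp
    rw [this, map_sub, hψ _ (by omega) (by omega), hψ _ (by omega) (by omega)]
    push_cast
    ring
  obtain ⟨f, -, -, hf⟩ := b.exists_root_eq_sum_int γ
  have h1 : ψ (P.root γ) = b.height γ := by
    rw [b.height_eq_sum hf, hf, map_sum]
    push_cast
    refine Finset.sum_congr rfl fun i hi ↦ ?_
    rw [map_zsmul, hsimple ⟨i, hi⟩]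
    simp
  rw [h, map_sub, hψ _ hi hi', hψ _ hj hj'] at h1
  have h2 : ((n + 1 - i : ℤ) - (n + 1 - j : ℤ)) = b.height γ := by exact_mod_cast h1
  omega

/-- The permutation of the indices of the vectors `ε_j` induced by the reflection in the simple root
`α_k`. -/
def stdPerm (n k j : ℕ) : ℕ :=
  if k < n then
    if j = k then k + 1 else if j = k + 1 then k
    else if j + k = 2 * n + 2 then 2 * n + 1 - k else if j + k = 2 * n + 1 then 2 * n + 2 - k else j
  else if j = n then n + 2 else if j = n + 2 then n else j

theorem coroot'_stdVector (he : ∀ i j, b.cartanMatrix (e i) (e j) = CartanMatrix.B n i j) {k j : ℕ}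
    (hk : 1 ≤ k) (hkn : k ≤ n) (hj : 1 ≤ j) (hjn : j ≤ n + 1) :
    P.coroot' (e ⟨k - 1, by omega⟩) (stdVector e j) =
      ((if j = k then (if k = n then 2 else 1) else if j = k + 1 ∧ k < n then -1 else 0 : ℤ) : K) := by
  have hs {m : ℕ} (h1 : 1 ≤ m) (hm : m ≤ n) :
      P.coroot' (e ⟨k - 1, by omega⟩) (numberedRoot e m) =
        ((if m = k then 2 else if m + 1 = k then (if k = n then -2 else -1)
          else if k + 1 = m then -1 else 0 : ℤ) : K) := by
    rw [numberedRoot, dif_pos (by omega), root_coroot'_eq_pairing,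
      ← b.algebraMap_cartanMatrixIn_apply ℤ]
    refine (congrArg _ (he _ _)).trans ?_
    rw [CartanMatrix.B, Matrix.of_apply, eq_intCast]
    congr 1
    simp only [Fin.mk.injEq]
    split_ifs <;> first | rfl | omega
  induction hd : n + 1 - j generalizing j with
  | zero =>
    obtain rfl : j = n + 1 := by omega
    rw [stdVector_mid, map_zero, if_neg (by omega), if_neg (by omega), Int.cast_zero]
  | succ d ih =>
    rw [stdVector_eq_add (by omega), map_add, hs hj (by omega),
      ih (by omega) (by omega) hs (by omega), ← Int.cast_add]
    congr 1
    split_ifs <;> omega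

theorem reflection_stdVector (he : ∀ i j, b.cartanMatrix (e i) (e j) = CartanMatrix.B n i j)
    {k j : ℕ} (hk : 1 ≤ k) (hkn : k ≤ n) (hj : 1 ≤ j) (hjn : j ≤ 2 * n + 1) :
    P.reflection (e ⟨k - 1, by omega⟩) (stdVector e j) = stdVector e (stdPerm n k j) := by
  have hroot : P.root (e ⟨k - 1, by omega⟩) = stdVector e k - stdVector e (k + 1) := by
    rw [stdVector_eq_add hkn, numberedRoot, dif_pos (by omega)]
    simp
  have hle {j : ℕ} (hj : 1 ≤ j) (hjn : j ≤ n + 1) :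
      P.reflection (e ⟨k - 1, by omega⟩) (stdVector e j) = stdVector e (stdPerm n k j) := by
    rw [reflection_apply, coroot'_stdVector he hk hkn hj hjn, hroot]
    rcases hkn.lt_or_eq with hlt | rfl
    · by_cases h1 : j = k
      · subst h1
        simp [stdPerm, hlt, hlt.ne]
      · by_cases h2 : j = k + 1
        · subst h2
          simp [stdPerm, hlt]
        · rw [if_neg h1, if_neg (by omega), stdPerm, if_pos hlt, if_neg h1, if_neg h2,
            if_neg (by omega), if_neg (by omega)]
          simp
    · by_cases h1 : j = k
      · subst h1
        have := stdVector_mirror (e := e) (k := j) (by omega)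
        rw [show 2 * j + 2 - j = j + 2 by omega] at this
        simp [stdPerm, stdVector_mid, this, two_smul]
      · rw [if_neg h1, if_neg (by omega), stdPerm, if_neg (by omega), if_neg h1, if_neg (by omega)]
        simp
  rcases le_or_gt j (n + 1) with h | h
  · exact hle hj h
  · have h1 := hle (j := 2 * n + 2 - j) (by omega) (by omega)
    rw [stdVector_mirror (by omega), map_neg] at h1
    rw [← neg_inj, h1, ← stdVector_mirror]
    · congr 1
      unfold stdPerm
      split_ifs <;> omega
    · unfold stdPerm
      split_ifs <;> omega

theorem stdPerm_bounds {n k j : ℕ} (hk : 1 ≤ k) (hj : 1 ≤ j) (hjn : j ≤ 2 * n + 1) :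
    1 ≤ stdPerm n k j ∧ stdPerm n k j ≤ 2 * n + 1 := by
  unfold stdPerm
  split_ifs <;> omega

theorem stdPerm_stdPerm {n k j : ℕ} (hk : 1 ≤ k) (hj : 1 ≤ j) :
    stdPerm n k (stdPerm n k j) = j := by
  unfold stdPerm
  split_ifs <;> omega

theorem stdPerm_mirror {n k j : ℕ} (hkn : k ≤ n) (hjn : j ≤ 2 * n + 1) :
    stdPerm n k (2 * n + 2 - j) = 2 * n + 2 - stdPerm n k j := by
  unfold stdPerm
  split_ifs <;> omega

theorem exists_root_eq_stdVector_sub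
    (he : ∀ i j, b.cartanMatrix (e i) (e j) = CartanMatrix.B n i j) (γ : ι) :
    ∃ i j, 1 ≤ i ∧ i ≤ 2 * n + 1 ∧ 1 ≤ j ∧ j ≤ 2 * n + 1 ∧ i ≠ j ∧ i + j ≠ 2 * n + 2 ∧
      P.root γ = stdVector e i - stdVector e j := by
  refine b.induction_reflect (p := fun γ ↦ ∃ i j, 1 ≤ i ∧ i ≤ 2 * n + 1 ∧ 1 ≤ j ∧ j ≤ 2 * n + 1 ∧
    i ≠ j ∧ i + j ≠ 2 * n + 2 ∧ P.root γ = stdVector e i - stdVector e j) γ ?_ ?_ ?_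
  · rintro γ ⟨i, j, hi, hi', hj, hj', hij, hij', h⟩
    exact ⟨j, i, hj, hj', hi, hi', hij.symm, by omega, by
      rw [root_reflectionPerm, reflection_apply_self, h, neg_sub]⟩
  · intro γ hγ
    obtain ⟨k, hk⟩ := e.surjective ⟨γ, hγ⟩
    refine ⟨k + 1, k + 2, by omega, by omega, by omega, by omega, by omega, by omega, ?_⟩
    rw [stdVector_eq_add (by omega), numberedRoot, dif_pos (by omega)]
    simp [hk]
  · rintro γ α ⟨i, j, hi, hi', hj, hj', hij, hij', h⟩ hα
    obtain ⟨⟨k, hkn⟩, hk⟩ := e.surjective ⟨α, hα⟩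
    have hr {j : ℕ} (hj : 1 ≤ j) (hjn : j ≤ 2 * n + 1) :
        P.reflection α (stdVector e j) = stdVector e (stdPerm n (k + 1) j) := by
      rw [← reflection_stdVector he (by omega) (by omega) hj hjn]
      simp [hk]
    have hbi := stdPerm_bounds (k := k + 1) (by omega) hi hi'
    have hbj := stdPerm_bounds (k := k + 1) (by omega) hj hj'
    refine ⟨_, _, hbi.1, hbi.2, hbj.1, hbj.2, fun hne ↦ hij ?_, fun hne ↦ hij' ?_, ?_⟩
    · rw [← stdPerm_stdPerm (k := k + 1) (by omega) hi, hne,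
        stdPerm_stdPerm (by omega) hj]
    · have : i = 2 * n + 2 - j := by
        rw [← stdPerm_stdPerm (k := k + 1) (by omega) hi,
          show stdPerm n (k + 1) i = 2 * n + 2 - stdPerm n (k + 1) j by omega,
          stdPerm_mirror (by omega) hbj.2,
          stdPerm_stdPerm (by omega) hj]
      omega
    · rw [root_reflectionPerm, h, map_sub, hr hi hi', hr hj hj']

/-- Simple reflections carry simple roots to all these differences: from ε_i - ε_{i+1} the second
index moves up to `n`, `α_n` sends it to `n + 2`, and further reflections move it on. The column `n
+ 1` comes from `α_n` by lowering the first index. -/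
theorem stdVector_sub_mem_range
    (he : ∀ i j, b.cartanMatrix (e i) (e j) = CartanMatrix.B n i j) {i j : ℕ} (hi : 1 ≤ i)
    (hij : i < j) (hj : i + j ≤ 2 * n + 1) : stdVector e i - stdVector e j ∈ Set.range P.root := by
  have hsimple {k : ℕ} (hk : 1 ≤ k) (hkn : k ≤ n) :
      stdVector e k - stdVector e (k + 1) ∈ Set.range P.root := by
    refine ⟨e ⟨k - 1, by omega⟩, ?_⟩
    rw [stdVector_eq_add hkn, numberedRoot, dif_pos (by omega)]
    simp
  have hstep {k i j i' j' : ℕ} (hk : 1 ≤ k) (hkn : k ≤ n) (hi : 1 ≤ i) (hi' : i ≤ 2 * n + 1)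
      (hj : 1 ≤ j) (hj' : j ≤ 2 * n + 1) (hii' : stdPerm n k i = i') (hjj' : stdPerm n k j = j')
      (h : stdVector e i - stdVector e j ∈ Set.range P.root) :
      stdVector e i' - stdVector e j' ∈ Set.range P.root := by
    obtain ⟨γ, hγ⟩ := h
    refine ⟨P.reflectionPerm (e ⟨k - 1, by omega⟩) γ, ?_⟩
    rw [root_reflectionPerm, hγ, map_sub, reflection_stdVector he hk hkn hi hi',
      reflection_stdVector he hk hkn hj hj', hii', hjj']
  have hmid {i : ℕ} (hi : 1 ≤ i) (hin : i ≤ n) :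
      stdVector e i - stdVector e (n + 1) ∈ Set.range P.root := by
    induction hd : n - i generalizing i with
    | zero =>
      obtain rfl : i = n := by omega
      exact hsimple hi le_rfl
    | succ d ih =>
      refine hstep (k := i) (i := i + 1) (j := n + 1) hi (by omega) (by omega) (by omega) (by omega)
        (by omega) ?_ ?_ (ih (by omega) (by omega) (by omega)) <;>
      · unfold stdPerm
        split_ifs <;> omega
  have hle {j : ℕ} (hij : i < j) (hj : j ≤ n) :
      stdVector e i - stdVector e j ∈ Set.range P.root := by
    induction j, hij using Nat.le_induction with
    | base => exact hsimple hi (by omega)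
    | succ j hij ih =>
      refine hstep (k := j) (i := i) (j := j) (by omega) (by omega) (by omega) (by omega) (by omega)
        (by omega) ?_ ?_ (ih (by omega)) <;>
      · unfold stdPerm
        split_ifs <;> omega
  rcases lt_trichotomy j (n + 1) with h | rfl | h
  · exact hle hij (by omega)
  · exact hmid hi (by omega)
  · replace h : n + 2 ≤ j := h
    induction j, h using Nat.le_induction with
    | base =>
      refine hstep (k := n) (i := i) (j := n) (by omega) (by omega) (by omega) (by omega) (by omega)
        (by omega) ?_ ?_ (hle (by omega) le_rfl) <;>
      · unfold stdPerm
        split_ifs <;> omega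
    | succ j hnj ih =>
      refine hstep (k := 2 * n + 1 - j) (i := i) (j := j) (by omega) (by omega) (by omega) (by omega)
        (by omega) (by omega) ?_ ?_ (ih (by omega) (by omega)) <;>
      · unfold stdPerm
        split_ifs <;> omega

theorem IsPos.exists_root_eq_stdVector_sub
    (he : ∀ i j, b.cartanMatrix (e i) (e j) = CartanMatrix.B n i j) {γ : ι} (hγ : b.IsPos γ) :
    ∃ i j, 1 ≤ i ∧ i < j ∧ i + j ≤ 2 * n + 1 ∧ P.root γ = stdVector e i - stdVector e j := by
  obtain ⟨i, j, hi, hi', hj, hj', hij, hij', h⟩ := Base.exists_root_eq_stdVector_sub he γ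
  have hht := height_eq_of_root_eq_sub hi hi' hj hj' h
  rw [isPos_iff] at hγ
  rcases hij'.lt_or_gt with hlt | hgt
  · exact ⟨i, j, hi, by omega, by omega, h⟩
  · refine ⟨2 * n + 2 - j, 2 * n + 2 - i, by omega, by omega, by omega, ?_⟩
    rw [h, stdVector_mirror (by omega), stdVector_mirror (by omega)]
    abel

theorem stdVector_sub_injective (e : Fin n ≃ b.support) {i j k l : ℕ} (hi : 1 ≤ i) (hij : i < j)
    (hij' : i + j ≤ 2 * n + 1) (hk : 1 ≤ k) (hkl : k < l) (hkl' : k + l ≤ 2 * n + 1)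
    (h : stdVector e i - stdVector e j = stdVector e k - stdVector e l) : i = k ∧ j = l := by
  have key (m : ℕ) (hm : m ≤ n) : ((if i = m then 1 else 0) - (if j = m then 1 else 0)
      + (if j + m = 2 * n + 2 then 1 else 0) : ℤ) = (if k = m then 1 else 0)
      - (if l = m then 1 else 0) + (if l + m = 2 * n + 2 then 1 else 0) := by
    obtain ⟨ψ, hψ⟩ := exists_linearMap_stdVector e (fun a ↦ (if a = m then 1 else 0)
      - (if a + m = 2 * n + 2 then 1 else 0)) (fun a h1 h2 ↦ by grind)
    have := congrArg ψ h
    rw [map_sub, map_sub, hψ _ (by omega) (by omega), hψ _ (by omega) (by omega),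
      hψ _ (by omega) (by omega), hψ _ (by omega) (by omega)] at this
    norm_cast at this
    grind
  have h1 := key i (by omega)
  have h2 := key k (by omega)
  rw [if_pos rfl, if_neg (by omega), if_neg (by omega)] at h1
  rw [if_pos rfl, if_neg (show ¬l = k by omega), if_neg (show ¬l + k = 2 * n + 2 by omega)] at h2
  have h1' : k = i ∨ l + i = 2 * n + 2 := by
    split_ifs at h1 <;> omega
  have h2' : i = k ∨ j + k = 2 * n + 2 := by
    split_ifs at h2 <;> omega
  obtain rfl : i = k := by omega
  refine ⟨rfl, ?_⟩
  have h3 := key (min j (2 * n + 2 - j))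
  have h4 := key (min l (2 * n + 2 - l))
  clear key h h1 h2 h1' h2'
  by_cases hj : min j (2 * n + 2 - j) ≤ n
  · have := h3 hj
    split_ifs at this <;> omega
  · by_cases hl : min l (2 * n + 2 - l) ≤ n
    · have := h4 hl
      split_ifs at this <;> omega
    · omega

theorem chain_of_stdVector_sub_add (e : Fin n ≃ b.support) {i j k l p q : ℕ} (hi : 1 ≤ i)
    (hij : i < j) (hij' : i + j ≤ 2 * n + 1) (hk : 1 ≤ k) (hkl : k < l) (hkl' : k + l ≤ 2 * n + 1)
    (hp : 1 ≤ p) (hpq : p < q) (hpq' : p + q ≤ 2 * n + 1)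
    (h : stdVector e p - stdVector e q =
      (stdVector e i - stdVector e j) + (stdVector e k - stdVector e l)) :
    i = l ∨ j = k ∨ j + l = 2 * n + 2 := by
  by_contra! hne
  -- Without cancellation, the odd function built from `S` is 1 at `i`, `k` and -1 at `j`, `l`, or 0
  -- at one of the latter if it is `n + 1`. The right side is then at least 3, while a difference of
  -- two values is at most 2.
  let S : ℕ → ℤ := fun a ↦ if a = i ∨ a = k ∨ a + j = 2 * n + 2 ∨ a + l = 2 * n + 2 then 1 else 0
  obtain ⟨ψ, hψ⟩ := exists_linearMap_stdVector e (fun a ↦ S a - S (2 * n + 2 - a)) (fun a h1 h2 ↦ by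
    rw [Nat.sub_sub_self (by omega)]
    ring)
  have := congrArg ψ h
  rw [map_add, map_sub, map_sub, map_sub, hψ _ (by omega) (by omega), hψ _ (by omega) (by omega),
    hψ _ (by omega) (by omega), hψ _ (by omega) (by omega), hψ _ (by omega) (by omega),
    hψ _ (by omega) (by omega)] at this
  norm_cast at this
  have hgi : S i - S (2 * n + 2 - i) = 1 := by
    simp only [S]
    rw [if_pos (by simp), if_neg (by omega), sub_zero]
  have hgk : S k - S (2 * n + 2 - k) = 1 := by
    simp only [S]
    rw [if_pos (by simp), if_neg (by omega), sub_zero]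
  have hgj : j = n + 1 ∧ S j - S (2 * n + 2 - j) = 0 ∨ S j - S (2 * n + 2 - j) = -1 := by
    by_cases hmid : j = n + 1
    · rw [show 2 * n + 2 - j = j by omega, sub_self]
      exact Or.inl ⟨hmid, rfl⟩
    · simp only [S]
      rw [if_neg (by omega), if_pos (by omega)]
      exact Or.inr rfl
  have hgl : l = n + 1 ∧ S l - S (2 * n + 2 - l) = 0 ∨ S l - S (2 * n + 2 - l) = -1 := by
    by_cases hmid : l = n + 1
    · rw [show 2 * n + 2 - l = l by omega, sub_self]
      exact Or.inl ⟨hmid, rfl⟩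
    · simp only [S]
      rw [if_neg (by omega), if_pos (by omega)]
      exact Or.inr rfl
  have hS (a : ℕ) : 0 ≤ S a ∧ S a ≤ 1 := by
    simp only [S]
    split_ifs <;> omega
  have := hS p
  have := hS q
  have := hS (2 * n + 2 - p)
  have := hS (2 * n + 2 - q)
  omega

end RootPairing.Base

namespace RootPairing.Base

variable {ι K M N : Type*} [Finite ι] [Field K] [CharZero K] [AddCommGroup M] [Module K M]
  [AddCommGroup N] [Module K N] {P : RootPairing ι K M N} [P.IsRootSystem] [P.IsCrystallographic]
  [P.IsReduced] {b : P.Base} {n : ℕ} {e : Fin n ≃ b.support}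

theorem exists_isPos_root_eq_stdVector_sub
    (he : ∀ i j, b.cartanMatrix (e i) (e j) = CartanMatrix.B n i j) {i j : ℕ} (hi : 1 ≤ i)
    (hij : i < j) (hj : j ≤ 2 * n + 1) (hne : i + j ≠ 2 * n + 2) :
    ∃ γ, b.IsPos γ ∧ P.root γ = stdVector e i - stdVector e j := by
  obtain ⟨γ, hγ⟩ : stdVector e i - stdVector e j ∈ Set.range P.root := by
    rcases hne.lt_or_gt with hlt | hgt
    · exact stdVector_sub_mem_range he hi hij (by omega)
    · have := stdVector_sub_mem_range he (i := 2 * n + 2 - j) (j := 2 * n + 2 - i) (by omega)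
        (by omega) (by omega)
      rw [stdVector_mirror (by omega), stdVector_mirror (by omega)] at this
      rwa [← neg_sub_neg]
  refine ⟨γ, ?_, hγ⟩
  have := height_eq_of_root_eq_sub hi (by omega) (by omega) hj hγ
  rw [isPos_iff]
  omega

/-- The right side is 2ε_k, whose coordinates are even, while the ε_i-coordinate on the left is 1.
This keeps the links of a chain off the antidiagonal. -/
theorem stdVector_sub_ne (e : Fin n ≃ b.support) {i j k : ℕ} (hi : 1 ≤ i) (hij : i < j)
    (hij' : i + j ≤ 2 * n + 1) (hk : 1 ≤ k) (hk' : k ≤ 2 * n + 1) :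
    stdVector e i - stdVector e j ≠ stdVector e k - stdVector e (2 * n + 2 - k) := by
  intro h
  obtain ⟨ψ, hψ⟩ := exists_linearMap_stdVector e (fun a ↦ (if a = i then 1 else 0)
    - (if a + i = 2 * n + 2 then 1 else 0)) (fun a h1 h2 ↦ by grind)
  rw [stdVector_mirror (by omega), sub_neg_eq_add] at h
  have := congrArg ψ h
  rw [map_sub, map_add, hψ _ (by omega) (by omega), hψ _ (by omega) (by omega),
    hψ _ (by omega) (by omega)] at this
  rw [← Int.cast_sub, ← Int.cast_add, Int.cast_inj] at this
  rw [if_pos rfl, if_neg (by omega), if_neg (by omega), if_neg (by omega)] at this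
  split_ifs at this <;> omega

/-- If a sum of two positive roots is a root, then the three roots are `ε_x - ε_y`, `ε_y - ε_z`
and `ε_x - ε_z` for some `x < y < z`. -/
theorem exists_chain_of_root_eq_add
    (he : ∀ i j, b.cartanMatrix (e i) (e j) = CartanMatrix.B n i j) {α β γ : ι} (hα : b.IsPos α)
    (hβ : b.IsPos β) (h : P.root γ = P.root α + P.root β) :
    ∃ x y z, 1 ≤ x ∧ x < y ∧ y < z ∧ z ≤ 2 * n + 1 ∧ x + y ≠ 2 * n + 2 ∧ y + z ≠ 2 * n + 2 ∧
      x + z ≠ 2 * n + 2 ∧ P.root γ = stdVector e x - stdVector e z ∧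
      (P.root α = stdVector e x - stdVector e y ∧ P.root β = stdVector e y - stdVector e z ∨
        P.root β = stdVector e x - stdVector e y ∧ P.root α = stdVector e y - stdVector e z) := by
  obtain ⟨p, q, hp, hpq, hpq', hγ'⟩ := (hα.add hβ h).exists_root_eq_stdVector_sub he
  obtain ⟨i, j, hi, hij, hij', hα'⟩ := hα.exists_root_eq_stdVector_sub he
  obtain ⟨k, l, hk, hkl, hkl', hβ'⟩ := hβ.exists_root_eq_stdVector_sub he
  have hne {x z : ℕ} (hx : 1 ≤ x) (hx' : x ≤ 2 * n + 1)
      (hγ : P.root γ = stdVector e x - stdVector e z) : x + z ≠ 2 * n + 2 := fun hxz ↦ by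
    refine stdVector_sub_ne e hp hpq hpq' hx hx' ?_
    rw [← hγ', hγ, show 2 * n + 2 - x = z by omega]
  have hcases := chain_of_stdVector_sub_add e hi hij hij' hk hkl hkl' hp hpq hpq'
    (by rw [← hγ', ← hα', ← hβ', h])
  rcases hcases with rfl | rfl | hjl
  · have hγ : P.root γ = stdVector e k - stdVector e j := by
      rw [h, hα', hβ']
      abel
    exact ⟨k, i, j, hk, hkl, hij, by omega, by omega, by omega, hne hk (by omega) hγ, hγ,
      Or.inr ⟨hβ', hα'⟩⟩
  · have hγ : P.root γ = stdVector e i - stdVector e l := by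
      rw [h, hα', hβ']
      abel
    exact ⟨i, j, l, hi, hij, hkl, by omega, by omega, by omega, hne hi (by omega) hγ, hγ,
      Or.inl ⟨hα', hβ'⟩⟩
  · have hl : stdVector e l = -stdVector e j := by
      rw [← stdVector_mirror (by omega)]
      congr 1
      omega
    have hk' := stdVector_mirror (e := e) (k := k) (by omega)
    have hγ : P.root γ = stdVector e i - stdVector e (2 * n + 2 - k) := by
      rw [h, hα', hβ', hk', hl]
      abel
    refine ⟨i, j, 2 * n + 2 - k, hi, hij, by omega, by omega, by omega, by omega,
      hne hi (by omega) hγ, hγ, Or.inl ⟨hα', ?_⟩⟩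
    rw [hβ', hk', hl]
    abel

end RootPairing.Base

/-! ### Filters of positive roots as filters of cells -/

section Cells

open RootPairing.Base

variable {L : Type*} [LieRing L] [LieAlgebra ℂ L] [FiniteDimensional ℂ L] [LieAlgebra.IsSimple ℂ L]
  {H : LieSubalgebra ℂ L} [H.IsCartanSubalgebra] {b : (rootSystem H).Base} {n : ℕ}
  {e : Fin n ≃ b.support}

/-- The pairs `(i, j)` with `1 ≤ i < j` and `i + j ≤ 2n + 1` such that the root `ε_i - ε_j` lies in
`Φ`. -/
def rootCells (e : Fin n ≃ b.support) (Φ : Set H.root) : Set (ℕ × ℕ) :=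
  {c | 1 ≤ c.1 ∧ c.1 < c.2 ∧ c.1 + c.2 ≤ 2 * n + 1 ∧
    ∃ γ ∈ Φ, (rootSystem H).root γ = stdVector e c.1 - stdVector e c.2}

theorem mem_of_root_eq {Φ : Set H.root} {γ γ' : H.root} (hγ : γ ∈ Φ)
    (h : (rootSystem H).root γ' = (rootSystem H).root γ) : γ' ∈ Φ := by
  rwa [(rootSystem H).root.injective h]

theorem foldMem_rootCells_iff {Φ : Set H.root} {i j : ℕ} :
    FoldMem n (rootCells e Φ) i j ↔ 1 ≤ i ∧ i < j ∧ j ≤ 2 * n + 1 ∧ i + j ≠ 2 * n + 2 ∧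
      ∃ γ ∈ Φ, (rootSystem H).root γ = stdVector e i - stdVector e j := by
  constructor
  · rintro (⟨h, h1, h2, h3, h4⟩ | ⟨h, h1, h2, h3, γ, hγ, h4⟩) <;> simp only at h1 h2 h3 h4
    · exact ⟨h1, h2, by omega, by omega, h4⟩
    · refine ⟨by omega, by omega, by omega, by omega, γ, hγ, ?_⟩
      rw [h4, stdVector_mirror (by omega), stdVector_mirror (by omega), neg_sub_neg]
  · rintro ⟨h1, h2, h3, h4, γ, hγ, h5⟩
    rcases h4.lt_or_gt with h | h
    · exact Or.inl ⟨h, h1, h2, by simp only; omega, γ, hγ, h5⟩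
    · refine Or.inr ⟨h, by simp only; omega, by simp only; omega, by simp only; omega, γ, hγ, ?_⟩
      rw [h5, stdVector_mirror (by omega), stdVector_mirror (by omega), neg_sub_neg]

theorem rootCells_mem_rootFilters
    (he : ∀ i j, b.cartanMatrix (e i) (e j) = CartanMatrix.B n i j) {Φ : Set H.root}
    (hΦ : IsPosFilter b Φ) : rootCells e Φ ∈ rootFilters n 1 2 := by
  have hadd {γ α β : H.root} (hα : b.IsPos α) (hβ : β ∈ Φ)
      (h : (rootSystem H).root γ = (rootSystem H).root α + (rootSystem H).root β) : γ ∈ Φ :=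
    hΦ.2 ⟨α, hα, β, hβ, h⟩
  refine ⟨?_, ?_, ?_⟩
  · rintro k y ⟨h1, h2, h3, -⟩
    simp only at h1 h2 h3
    omega
  · rintro k y ⟨h1, h2, h3, β, hβ, h4⟩ h
    simp only at h1 h2 h3 h4
    obtain ⟨α, hα, hα'⟩ := exists_isPos_root_eq_stdVector_sub he (i := y) (j := y + 1) (by omega)
      (by omega) (by omega) (by omega)
    obtain ⟨γ, -, hγ⟩ := exists_isPos_root_eq_stdVector_sub he (i := k) (j := y + 1) (by omega)
      (by omega) (by omega) (by omega)
    refine ⟨h1, by simp only; omega, by simp only; omega, γ, hadd hα hβ ?_, hγ⟩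
    rw [hγ, hα', h4]
    abel
  · rintro k y ⟨h1, h2, h3, β, hβ, h4⟩ h
    simp only at h1 h2 h3 h4
    obtain ⟨α, hα, hα'⟩ := exists_isPos_root_eq_stdVector_sub he (i := k) (j := k + 1) (by omega)
      (by omega) (by omega) (by omega)
    obtain ⟨γ, -, hγ⟩ := exists_isPos_root_eq_stdVector_sub he (i := k) (j := y) (by omega)
      (by omega) (by omega) (by omega)
    refine ⟨h, by simp only; omega, by simp only; omega, γ, hadd hα hβ ?_, hγ⟩
    rw [hγ, hα', h4]
    abel

theorem rootCells_injOn (he : ∀ i j, b.cartanMatrix (e i) (e j) = CartanMatrix.B n i j) :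
    Set.InjOn (rootCells e) {Φ | IsPosFilter b Φ} := by
  have key {Φ Ψ : Set H.root} (hΦ : IsPosFilter b Φ) (h : rootCells e Φ = rootCells e Ψ) :
      Φ ⊆ Ψ := by
    intro γ hγ
    obtain ⟨i, j, hi, hij, hj, h1⟩ := (hΦ.1 γ hγ).exists_root_eq_stdVector_sub he
    have : (i, j) ∈ rootCells e Ψ := h ▸ ⟨hi, hij, hj, γ, hγ, h1⟩
    obtain ⟨-, -, -, γ', hγ', h2⟩ := this
    exact mem_of_root_eq hγ' (h1.trans h2.symm)
  exact fun Φ hΦ Ψ hΨ h ↦ (key hΦ h).antisymm (key hΨ h.symm)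

theorem exists_isPosFilter_of_mem_rootFilters
    (he : ∀ i j, b.cartanMatrix (e i) (e j) = CartanMatrix.B n i j) {D : Set (ℕ × ℕ)}
    (hD : D ∈ rootFilters n 1 2) : ∃ Φ : Set H.root, IsPosFilter b Φ ∧ rootCells e Φ = D := by
  let Φ : Set H.root :=
    {γ | ∃ i j, FoldMem n D i j ∧ (rootSystem H).root γ = stdVector e i - stdVector e j}
  have hpos (γ : H.root) (hγ : γ ∈ Φ) : b.IsPos γ := by
    obtain ⟨i, j, h, hγ⟩ := hγ
    have hb := rootFilters.foldMem_bounds hD h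
    have := height_eq_of_root_eq_sub hb.1 (by omega) (by omega) hb.2.2 hγ
    rw [isPos_iff]
    omega
  have hcell {i j : ℕ} (hi : 1 ≤ i) (hij : i < j) (hj : i + j ≤ 2 * n + 1) {γ : H.root}
      (hγ : γ ∈ Φ) (h : (rootSystem H).root γ = stdVector e i - stdVector e j) : (i, j) ∈ D := by
    obtain ⟨k, l, hkl, h'⟩ := hγ
    rcases hkl with ⟨hlt, hm⟩ | ⟨hlt, hm⟩
    · have hb := hD.1 _ _ hm
      obtain ⟨rfl, rfl⟩ := stdVector_sub_injective e hi hij hj hb.1 hb.2.2.1 (by omega)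
        (h.symm.trans h')
      exact hm
    · have hb := hD.1 _ _ hm
      rw [h, ← neg_sub_neg (stdVector e l), ← stdVector_mirror (by omega),
        ← stdVector_mirror (by omega)] at h'
      obtain ⟨h1, h2⟩ := stdVector_sub_injective e hi hij hj hb.1 hb.2.2.1 (by omega) h'
      rwa [h1, h2]
  refine ⟨Φ, ⟨hpos, ?_⟩, ?_⟩
  · rintro γ ⟨α, hα, β, hβ, hγ⟩
    obtain ⟨x, y, z, hx, hxy, hyz, hz, hxy', hyz', hxz', h, h'⟩ :=
      exists_chain_of_root_eq_add he hα (hpos β hβ) hγ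
    refine ⟨x, z, ?_, h⟩
    have hmem {i j : ℕ} (hi : 1 ≤ i) (hij : i < j) (hj : j ≤ 2 * n + 1) (hne : i + j ≠ 2 * n + 2)
        (h : (rootSystem H).root β = stdVector e i - stdVector e j) : FoldMem n D i j := by
      rcases hne.lt_or_gt with hlt | hgt
      · exact rootFilters.foldMem_of_mem hD (hcell hi hij (by omega) hβ h)
      · refine Or.inr ⟨hgt, hcell (by omega) (by omega) (by omega) hβ ?_⟩
        rw [h, stdVector_mirror (by omega), stdVector_mirror (by omega), neg_sub_neg]
    -- The link of `β` is one of the two parts of the interval from `x` to `z`, so monotonicity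
    -- widens it to the link of the sum.
    rcases h' with ⟨-, h'⟩ | ⟨h', -⟩
    · exact rootFilters.foldMem_mono hD (hmem (by omega) hyz hz hyz' h') hx hxy.le le_rfl hz hxz'
    · exact rootFilters.foldMem_mono hD (hmem hx hxy (by omega) hxy' h') hx le_rfl hyz.le hz hxz'
  · ext ⟨i, j⟩
    constructor
    · rintro ⟨hi, hij, hj, γ, hγ, h⟩
      exact hcell hi hij hj hγ h
    · intro h
      have hb := hD.1 _ _ h
      obtain ⟨γ, -, hγ⟩ := exists_isPos_root_eq_stdVector_sub he (i := i) (j := j) hb.1 hb.2.2.1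
        (by omega) (by omega)
      exact ⟨hb.1, hb.2.2.1, hb.2.2.2, γ, ⟨i, j, rootFilters.foldMem_of_mem hD h, hγ⟩, hγ⟩

end Cells

/-! ### Iterated sums of roots as chains -/

/-- There is a chain of `k + 1` links of `D` from `i` to `j`. -/
def FoldChain (n : ℕ) (D : Set (ℕ × ℕ)) : ℕ → ℕ → ℕ → Prop
  | 0, i, j => FoldMem n D i j
  | k + 1, i, j => ∃ a, FoldMem n D i a ∧ FoldChain n D k a j

theorem FoldChain.append {n : ℕ} {D : Set (ℕ × ℕ)} {k i a j : ℕ} (h : FoldChain n D k i a)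
    (h' : FoldMem n D a j) : FoldChain n D (k + 1) i j := by
  induction k generalizing i with
  | zero => exact ⟨a, h, h'⟩
  | succ k ih =>
    obtain ⟨c, hc, h⟩ := h
    exact ⟨c, hc, ih h⟩

theorem FoldChain.mirror {n : ℕ} {D : Set (ℕ × ℕ)} (hD : D ∈ rootFilters n 1 2) {k i j : ℕ}
    (h : FoldChain n D k i j) : FoldChain n D k (2 * n + 2 - j) (2 * n + 2 - i) := by
  induction k generalizing i with
  | zero => exact rootFilters.foldMem_mirror hD h
  | succ k ih =>
    obtain ⟨a, ha, h⟩ := h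
    exact (ih h).append (rootFilters.foldMem_mirror hD ha)

section Chains

open RootPairing.Base

variable {L : Type*} [LieRing L] [LieAlgebra ℂ L] [FiniteDimensional ℂ L] [LieAlgebra.IsSimple ℂ L]
  {H : LieSubalgebra ℂ L} [H.IsCartanSubalgebra] {b : (rootSystem H).Base} {n : ℕ}
  {e : Fin n ≃ b.support}

/-- Each added root of `Φ` becomes the first or the last link of the chain already built. -/
theorem foldChain_of_mem_rootPow
    (he : ∀ i j, b.cartanMatrix (e i) (e j) = CartanMatrix.B n i j) {Φ : Set H.root}
    (hΦ : IsPosFilter b Φ) {k : ℕ} {γ : H.root} (hγ : γ ∈ rootPow Φ k) {i j : ℕ} (hi : 1 ≤ i)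
    (hij : i < j) (hj : j ≤ 2 * n + 1) (hne : i + j ≠ 2 * n + 2)
    (h : (rootSystem H).root γ = stdVector e i - stdVector e j) :
    FoldChain n (rootCells e Φ) k i j := by
  have hD := rootCells_mem_rootFilters he hΦ
  induction k generalizing γ i j with
  | zero => exact foldMem_rootCells_iff.2 ⟨hi, hij, hj, hne, γ, hγ, h⟩
  | succ k ih =>
    obtain ⟨α, hα, β, hβ, hαβ⟩ := hγ
    obtain ⟨x, y, z, hx, hxy, hyz, hz, hxy', hyz', hxz', hγ, h'⟩ :=
      exists_chain_of_root_eq_add he (hΦ.1 α hα) (hΦ.1 β (rootPow_subset hΦ k hβ)) hαβ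
    have hxz : FoldChain n (rootCells e Φ) (k + 1) x z := by
      rcases h' with ⟨h1, h2⟩ | ⟨h1, h2⟩
      · exact ⟨y, foldMem_rootCells_iff.2 ⟨hx, hxy, by omega, hxy', α, hα, h1⟩,
          ih hβ (by omega) hyz hz hyz' h2⟩
      · exact (ih hβ hx hxy (by omega) hxy' h1).append
          (foldMem_rootCells_iff.2 ⟨by omega, hyz, hz, hyz', α, hα, h2⟩)
    have hxz'' := hxz.mirror hD
    have heq := h.symm.trans hγ
    have hm {a c : ℕ} (ha : a ≤ 2 * n + 2) (hc : c ≤ 2 * n + 2) : stdVector e a - stdVector e c =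
        stdVector e (2 * n + 2 - c) - stdVector e (2 * n + 2 - a) := by
      rw [stdVector_mirror ha, stdVector_mirror hc, neg_sub_neg]
    -- A root determines its pair of indices only up to the mirror, so `(i, j)` is `(x, z)` or its
    -- mirror.
    rcases hne.lt_or_gt with h1 | h1 <;> rcases hxz'.lt_or_gt with h2 | h2
    · obtain ⟨rfl, rfl⟩ := stdVector_sub_injective e hi hij (by omega) hx (by omega) (by omega) heq
      exact hxz
    · rw [hm (a := x) (by omega) (by omega)] at heq
      obtain ⟨rfl, rfl⟩ := stdVector_sub_injective e hi hij (by omega) (by omega) (by omega)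
        (by omega) heq
      exact hxz''
    · rw [hm (a := i) (by omega) (by omega)] at heq
      obtain ⟨h3, h4⟩ := stdVector_sub_injective e (by omega) (by omega) (by omega) hx (by omega)
        (by omega) heq
      rwa [← h3, ← h4, Nat.sub_sub_self (by omega), Nat.sub_sub_self (by omega)] at hxz''
    · rw [hm (a := i) (by omega) (by omega), hm (a := x) (by omega) (by omega)] at heq
      obtain ⟨h3, h4⟩ := stdVector_sub_injective e (by omega) (by omega) (by omega) (by omega)
        (by omega) (by omega) heq
      obtain rfl : i = x := by omega
      obtain rfl : j = z := by omega
      exact hxz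

theorem exists_mem_rootPow_succ
    (he : ∀ i j, b.cartanMatrix (e i) (e j) = CartanMatrix.B n i j) {Φ : Set H.root} {k x y z : ℕ}
    (hxz : x + z ≠ 2 * n + 2) (hx : 1 ≤ x) (hyz : x < z) (hz : z ≤ 2 * n + 1)
    (h : (∃ γ ∈ Φ, (rootSystem H).root γ = stdVector e x - stdVector e y) ∧
        (∃ γ ∈ rootPow Φ k, (rootSystem H).root γ = stdVector e y - stdVector e z) ∨
      (∃ γ ∈ rootPow Φ k, (rootSystem H).root γ = stdVector e x - stdVector e y) ∧
        (∃ γ ∈ Φ, (rootSystem H).root γ = stdVector e y - stdVector e z)) :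
    ∃ γ ∈ rootPow Φ (k + 1), (rootSystem H).root γ = stdVector e x - stdVector e z := by
  obtain ⟨γ, -, hγ⟩ := exists_isPos_root_eq_stdVector_sub he hx hyz hz hxz
  refine ⟨γ, ?_, hγ⟩
  rcases h with ⟨⟨α, hα, hα'⟩, β, hβ, hβ'⟩ | ⟨⟨β, hβ, hβ'⟩, α, hα, hα'⟩ <;>
  · refine ⟨α, hα, β, hβ, ?_⟩
    rw [hγ, hα', hβ']
    abel

/-- The ends of a chain can be widened to 1 and `2 * n`. Conversely, in a chain from 1 every partial
sum ε_1 - ε_d has `d ≤ 2 * n`, so it is a root, and the links can be added from left to right. -/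
theorem rootPow_two_eq_empty_iff
    (he : ∀ i j, b.cartanMatrix (e i) (e j) = CartanMatrix.B n i j) {Φ : Set H.root}
    (hΦ : IsPosFilter b Φ) : rootPow Φ 2 = ∅ ↔ ¬ ∃ c d, FoldMem n (rootCells e Φ) 1 c ∧
      FoldMem n (rootCells e Φ) c d ∧ FoldMem n (rootCells e Φ) d (2 * n) := by
  have hD := rootCells_mem_rootFilters he hΦ
  rw [← Set.not_nonempty_iff_eq_empty, not_iff_not]
  constructor
  · rintro ⟨γ, hγ⟩
    obtain ⟨p, q, hp, hpq, hpq', h⟩ :=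
      (hΦ.1 γ (rootPow_subset hΦ _ hγ)).exists_root_eq_stdVector_sub he
    obtain ⟨c, hc, d, hcd, hd⟩ := foldChain_of_mem_rootPow he hΦ hγ hp hpq (by omega) (by omega) h
    have h1 := rootFilters.foldMem_bounds hD hc
    have h2 := rootFilters.foldMem_bounds hD hcd
    have h3 := rootFilters.foldMem_bounds hD hd
    exact ⟨c, d, rootFilters.foldMem_mono hD hc le_rfl hp le_rfl (by omega) (by omega), hcd,
      rootFilters.foldMem_mono hD hd (by omega) le_rfl (by omega) (by omega) (by omega)⟩
  · rintro ⟨c, d, hc, hcd, hd⟩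
    obtain ⟨-, h1, -, -, h1'⟩ := foldMem_rootCells_iff.1 hc
    obtain ⟨-, h2, -, -, h2'⟩ := foldMem_rootCells_iff.1 hcd
    obtain ⟨-, h3, -, -, h3'⟩ := foldMem_rootCells_iff.1 hd
    have hone := exists_mem_rootPow_succ (k := 0) he (show 1 + d ≠ 2 * n + 2 by omega) le_rfl
      (by omega) (by omega) (Or.inl ⟨h1', h2'⟩)
    obtain ⟨γ, hγ, -⟩ := exists_mem_rootPow_succ he (show 1 + 2 * n ≠ 2 * n + 2 by omega) le_rfl
      (by omega) (by omega) (Or.inr ⟨hone, h3'⟩)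
    exact ⟨γ, hγ⟩

theorem rootPow_three_eq_empty_iff
    (he : ∀ i j, b.cartanMatrix (e i) (e j) = CartanMatrix.B n i j) {Φ : Set H.root}
    (hΦ : IsPosFilter b Φ) : rootPow Φ 3 = ∅ ↔ ¬ ∃ c d f, FoldMem n (rootCells e Φ) 1 c ∧
      FoldMem n (rootCells e Φ) c d ∧ FoldMem n (rootCells e Φ) d f ∧
      FoldMem n (rootCells e Φ) f (2 * n) := by
  have hD := rootCells_mem_rootFilters he hΦ
  rw [← Set.not_nonempty_iff_eq_empty, not_iff_not]
  constructor
  · rintro ⟨γ, hγ⟩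
    obtain ⟨p, q, hp, hpq, hpq', h⟩ :=
      (hΦ.1 γ (rootPow_subset hΦ _ hγ)).exists_root_eq_stdVector_sub he
    obtain ⟨c, hc, d, hcd, f, hdf, hf⟩ :=
      foldChain_of_mem_rootPow he hΦ hγ hp hpq (by omega) (by omega) h
    have h1 := rootFilters.foldMem_bounds hD hc
    have h2 := rootFilters.foldMem_bounds hD hcd
    have h3 := rootFilters.foldMem_bounds hD hdf
    have h4 := rootFilters.foldMem_bounds hD hf
    exact ⟨c, d, f, rootFilters.foldMem_mono hD hc le_rfl hp le_rfl (by omega) (by omega), hcd, hdf,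
      rootFilters.foldMem_mono hD hf (by omega) le_rfl (by omega) (by omega) (by omega)⟩
  · rintro ⟨c, d, f, hc, hcd, hdf, hf⟩
    obtain ⟨-, h1, -, -, h1'⟩ := foldMem_rootCells_iff.1 hc
    obtain ⟨-, h2, -, -, h2'⟩ := foldMem_rootCells_iff.1 hcd
    obtain ⟨-, h3, -, -, h3'⟩ := foldMem_rootCells_iff.1 hdf
    obtain ⟨-, h4, -, -, h4'⟩ := foldMem_rootCells_iff.1 hf
    have hone := exists_mem_rootPow_succ (k := 0) he (show 1 + d ≠ 2 * n + 2 by omega) le_rfl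
      (by omega) (by omega) (Or.inl ⟨h1', h2'⟩)
    have htwo := exists_mem_rootPow_succ he (show 1 + f ≠ 2 * n + 2 by omega) le_rfl
      (by omega) (by omega) (Or.inr ⟨hone, h3'⟩)
    obtain ⟨γ, hγ, -⟩ := exists_mem_rootPow_succ he (show 1 + 2 * n ≠ 2 * n + 2 by omega) le_rfl
      (by omega) (by omega) (Or.inr ⟨htwo, h4'⟩)
    exact ⟨γ, hγ⟩

theorem ncard_isPosFilter_eq_ncard_rootFilters
    (he : ∀ i j, b.cartanMatrix (e i) (e j) = CartanMatrix.B n i j) {k : ℕ}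
    {p : Set (ℕ × ℕ) → Prop}
    (hp : ∀ Φ : Set H.root, IsPosFilter b Φ → (rootPow Φ k = ∅ ↔ p (rootCells e Φ))) :
    {Φ | IsPosFilter b Φ ∧ rootPow Φ k = ∅}.ncard = {D ∈ rootFilters n 1 2 | p D}.ncard := by
  refine Set.ncard_congr (fun Φ _ ↦ rootCells e Φ) ?_ ?_ ?_
  · rintro Φ ⟨hΦ, h⟩
    exact ⟨rootCells_mem_rootFilters he hΦ, (hp Φ hΦ).1 h⟩
  · rintro Φ Ψ ⟨hΦ, -⟩ ⟨hΨ, -⟩ h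
    exact rootCells_injOn he hΦ hΨ h
  · rintro D ⟨hD, h⟩
    obtain ⟨Φ, hΦ, rfl⟩ := exists_isPosFilter_of_mem_rootFilters (H := H) he hD
    exact ⟨Φ, ⟨hΦ, (hp Φ hΦ).2 h⟩, rfl⟩

end Chains

theorem corollaryB3 {L : Type*} [LieRing L] [LieAlgebra ℂ L] [FiniteDimensional ℂ L]
    [LieAlgebra.IsSimple ℂ L] (H : LieSubalgebra ℂ L) [H.IsCartanSubalgebra]
    (b : (LieAlgebra.IsKilling.rootSystem H).Base) (n : ℕ) (hn : 1 ≤ n) (hB : IsTypeB b n) :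
    ({I : LieIdeal ℂ (borelSubalgebra b) |
        IsAdNilpotentIdeal I ∧ nilpotenceClass I ≤ 2}.ncard : ℚ) =
      (fibonacci (2 * n) : ℚ) + (fibonacci (2 * n - 2) : ℚ) - 2 ^ (n - 1) ∧
    ({I : LieIdeal ℂ (borelSubalgebra b) |
        IsAdNilpotentIdeal I ∧ nilpotenceClass I ≤ 3}.ncard : ℚ) =
      (5 * 3 ^ (n - 1) + 1) / 2 - (fibonacci (2 * n - 2) : ℚ) := by
  obtain ⟨e, he⟩ := hB
  have h2 := rootFilters.ncard_not_exists_three_chain hn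
  have h3 := rootFilters.ncard_not_exists_four_chain hn
  rw [← ncard_isPosFilter_eq_ncard_rootFilters he fun Φ hΦ ↦ rootPow_two_eq_empty_iff he hΦ,
    ← ncard_adNilpotent_eq_ncard_isPosFilter] at h2
  rw [← ncard_isPosFilter_eq_ncard_rootFilters he fun Φ hΦ ↦ rootPow_three_eq_empty_iff he hΦ,
    ← ncard_adNilpotent_eq_ncard_isPosFilter] at h3
  rw [fibonacci, fibonacci, show 2 * n - 2 + 1 = 2 * n - 1 by omega]
  constructor
  · rw [eq_sub_iff_add_eq]
    exact_mod_cast h2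
  · rw [eq_sub_iff_add_eq, eq_div_iff two_ne_zero]
    have h3' := congrArg (Nat.cast : ℕ → ℚ) h3
    push_cast at h3'
    linarith
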